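/- Finite types are generated from the type $0$ (natural numbers) by forming $\sigma\to\tau$; write $1$ for $0\to 0$ and $2$ for $1\to 0$. The language $\mathsf{L}_\omega$ of higher-order arithmetic has variables of every finite type, application, the constants $0,1,+,\times$, the combinators $\Pi_{\rho,\tau}$, $\Sigma_{\delta,\rho,\tau}$, the recursor $\mathsf{R}_0$, and the relations $=_0$ and $<_0$ between objects of type $0$; equality of higher type is defined by $x=_{\sigma\to\tau}y:\equiv(\forall z^{\sigma})(xz=_{\tau}yz)$. Derivability is derivability in classical many-sorted first-order logic with equality of type $0$. Kohlenbach's base theory $\mathsf{RCA}_0^\omega$ consists of: the basic axioms of arithmetic for $0,1,+,\times,<$; the defining equations $\Pi xy=x$, $\Sigma xyz=xz(yz)$, $\mathsf{R}_0(f,m,0)=m$ and $\mathsf{R}_0(f,m,n+1)=f(n,\mathsf{R}_0(f,m,n))$; the axioms of extensionality $x=_\rho y\rightarrow f(x)=_\tau f(y)$ for all finite types $\rho,\tau$ and all $f$ of type $\rho\to\tau$; induction for quantifier-free formulas; and $\mathsf{QF\text{-}AC}^{1,0}$, i.e. $(\forall x^1)(\exists y^0)A(x,y)\rightarrow(\exists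 Y^2)(\forall x^1)A(x,Y(x))$ for quantifier-free $A$. Parameters of all finite types are allowed in both schemas. The system $\mathsf{ACA}_0^\omega$ is $\mathsf{RCA}_0^\omega$ plus the axiom $$(\exists^2):\quad(\exists\varphi^2\le_2 1)(\forall f^1)\big[(\exists n^0)(f(n)=0)\leftrightarrow\varphi(f)=0\big].$$ In $\mathsf{L}_\omega$, a real number is an object $x$ of type $1$ whose values $x(k)$ code rational numbers with $|x(k)-x(k+i)|\le 2^{-k}$ for all $k,i$; one puts $x\le_{\mathbb R}y$ if $x(k)\le y(k)+2^{-k+1}$ for all $k$, and $x=_{\mathbb R}y$ if $|x(k)-y(k)|\le 2^{-k+1}$ for all $k$. The space $[0,1]$ consists of the real numbers $x$ with $0\le_{\mathbb R}x\le_{\mathbb R}1$; both $[0,1]$ and $\mathbb{R}$ carry the equality $=_{\mathbb R}$. Baire space $\mathbb{N}^{\mathbb N}$ consists of all $f$ of type $1$, and Cantor space $C=2^{\mathbb N}$ of those $f$ of type $1$ with $f(n)\le 1$ for all $n$; both carry the equality $=_1$. For $X$ one of these four spaces with equality $=_X$, let $\mathsf{NIN}^X$ be the sentence of $\mathsf{L}_\omega$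 expressing that there is no injection from $X$ to $\mathbb{N}$: there is no $Y$ of type $2$ such that, for all $x,y\in X$, both $x=_Xy\rightarrow Y(x)=_0Y(y)$ and $Y(x)=_0Y(y)\rightarrow x=_Xy$. Write $\mathsf{NIN}$ for $\mathsf{NIN}^{[0,1]}$. **Theorem.** The system $\mathsf{ACA}_0^\omega$ proves $\mathsf{NIN}\leftrightarrow\mathsf{NIN}^{C}$, $\mathsf{NIN}^{C}\leftrightarrow\mathsf{NIN}^{\mathbb{N}^{\mathbb N}}$ and $\mathsf{NIN}^{\mathbb{N}^{\mathbb N}}\leftrightarrow\mathsf{NIN}^{\mathbb R}$. -/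

import Mathlib

namespace HORM

/-! The language of higher-order arithmetic. -/

/-- Finite types: `o` is the type of natural numbers, `σ ⇒ τ` the type of maps from `σ` to `τ`. -/
inductive Ty : Type
  | o : Ty
  | arr : Ty → Ty → Ty
  deriving DecidableEq

infixr:60 " ⇒ " => Ty.arr

/-- Type `1`: elements of Baire space. -/
abbrev Ty.t1 : Ty := Ty.o ⇒ Ty.o

/-- Type `2`: maps from Baire space to the natural numbers. -/
abbrev Ty.t2 : Ty := Ty.t1 ⇒ Ty.o

open Ty

/-- Terms of finite type. Variables are de Bruijn indices counted separately for each type: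
`var σ n` is bound by the `n`-th enclosing quantifier (from the inside, starting at `0`) among the
quantifiers over the type `σ`, and it is a free variable if there is no such quantifier.
The constants are `0`, `1`, `+`, `×`, the combinators `Π` (`comK`) and `Σ` (`comS`), and the
recursor `R₀` (`recO`) with values of type `o`. -/
inductive Tm : Ty → Type
  | var (σ : Ty) (n : ℕ) : Tm σ
  | zero : Tm o
  | one : Tm o
  | add : Tm (o ⇒ o ⇒ o)
  | mul : Tm (o ⇒ o ⇒ o)
  | comK (ρ τ : Ty) : Tm (ρ ⇒ τ ⇒ ρ)
  | comS (δ ρ τ : Ty) : Tm ((δ ⇒ ρ ⇒ τ) ⇒ (δ ⇒ ρ) ⇒ δ ⇒ τ)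
  | recO : Tm ((o ⇒ o ⇒ o) ⇒ o ⇒ o ⇒ o)
  | app {σ τ : Ty} (f : Tm (σ ⇒ τ)) (a : Tm σ) : Tm τ

infixl:100 " ⬝ " => Tm.app

/-- Formulas. The only primitive relations are `=` and `<` between terms of type `o`. -/
inductive Fml : Type
  | eq (s t : Tm o) : Fml
  | lt (s t : Tm o) : Fml
  | bot : Fml
  | imp (φ ψ : Fml) : Fml
  | all (σ : Ty) (φ : Fml) : Fml

infixr:25 " ⟹ " => Fml.imp

namespace Fml

/-! The remaining connectives, by their classical definitions. -/

def neg (φ : Fml) : Fml := φ ⟹ bot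
def and (φ ψ : Fml) : Fml := neg (φ ⟹ neg ψ)
def or (φ ψ : Fml) : Fml := neg φ ⟹ ψ
def iff (φ ψ : Fml) : Fml := and (φ ⟹ ψ) (ψ ⟹ φ)
def ex (σ : Ty) (φ : Fml) : Fml := neg (all σ (neg φ))

/-- Quantifier-free formulas (free variables of all finite types are allowed). -/
def QF : Fml → Prop
  | eq _ _ => True
  | lt _ _ => True
  | bot => True
  | imp φ ψ => QF φ ∧ QF ψ
  | all _ _ => False

end Fml

/-! Substitution. -/

/-- A simultaneous substitution of terms for all variables. -/
abbrev Sub : Type := (σ : Ty) → ℕ → Tm σ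

namespace Sub

/-- The substitution adding `m` to the indices of the variables of type `σ`. -/
def up (σ : Ty) (m : ℕ) : Sub := fun τ n => Tm.var τ (if τ = σ then n + m else n)

/-- Variable `0` of type `σ` goes to `t`, variable `n + 1` of type `σ` goes to `s σ n`,
and variables of other types go where `s` sends them. -/
def cons {σ : Ty} (t : Tm σ) (s : Sub) : Sub := fun τ n =>
  if h : σ = τ then
    match n with
    | 0 => h ▸ t
    | n + 1 => s τ n
  else s τ n

end Sub

def Tm.subst (s : Sub) : {σ : Ty} → Tm σ → Tm σ
  | _, .var σ n => s σ n
  | _, .zero => .zero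
  | _, .one => .one
  | _, .add => .add
  | _, .mul => .mul
  | _, .comK ρ τ => .comK ρ τ
  | _, .comS δ ρ τ => .comS δ ρ τ
  | _, .recO => .recO
  | _, .app f a => .app (f.subst s) (a.subst s)

/-- Weakening of a term that is put under `m` quantifiers over the type `σ`. -/
def Tm.wk (σ : Ty) (m : ℕ) {τ : Ty} (t : Tm τ) : Tm τ := t.subst (Sub.up σ m)

/-- The substitution that acts as `s` below a quantifier over `σ`. -/
def Sub.lift (σ : Ty) (s : Sub) : Sub := Sub.cons (Tm.var σ 0) fun τ n => (s τ n).wk σ 1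

def Fml.subst : Sub → Fml → Fml
  | s, .eq a b => .eq (a.subst s) (b.subst s)
  | s, .lt a b => .lt (a.subst s) (b.subst s)
  | _, .bot => .bot
  | s, .imp φ ψ => .imp (φ.subst s) (ψ.subst s)
  | s, .all σ φ => .all σ (φ.subst (s.lift σ))

/-- Weakening of a formula that is put under a quantifier over the type `σ`. -/
def Fml.wk (σ : Ty) (φ : Fml) : Fml := φ.subst (Sub.up σ 1)

/-- `φ.inst t` is `φ(t)` for `φ = φ(x)` with `x` the variable `0` of the type of `t`. -/
def Fml.inst {σ : Ty} (φ : Fml) (t : Tm σ) : Fml := φ.subst (Sub.cons t Tm.var)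

/-! Derivations. -/

/-- Natural deduction for classical many-sorted first-order logic with equality of type `o`.
`Prf T Δ φ`: the formula `φ` is derivable from the assumptions `Δ` and from the members of `T`;
the latter may contain free variables and are understood as universally quantified. -/
inductive Prf (T : Set Fml) : List Fml → Fml → Prop
  | theory {Δ φ} : φ ∈ T → Prf T Δ φ
  | hyp {Δ φ} : φ ∈ Δ → Prf T Δ φ
  | impI {Δ φ ψ} : Prf T (φ :: Δ) ψ → Prf T Δ (φ ⟹ ψ)
  | impE {Δ φ ψ} : Prf T Δ (φ ⟹ ψ) → Prf T Δ φ → Prf T Δ ψ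
  | raa {Δ φ} : Prf T (φ.neg :: Δ) .bot → Prf T Δ φ
  | allI {Δ σ φ} : Prf T (Δ.map (Fml.wk σ)) φ → Prf T Δ (.all σ φ)
  | allE {Δ σ φ} (t : Tm σ) : Prf T Δ (.all σ φ) → Prf T Δ (φ.inst t)
  | eqRefl {Δ} (t : Tm o) : Prf T Δ (.eq t t)
  | eqSubst {Δ} (φ : Fml) {s t : Tm o} :
      Prf T Δ (.eq s t) → Prf T Δ (φ.inst s) → Prf T Δ (φ.inst t)

/-- The theory `T` proves `φ`. -/
def Proves (T : Set Fml) (φ : Fml) : Prop := Prf T [] φ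

infix:20 " ⊩ " => Proves

/-! The systems `RCA₀^ω` and `ACA₀^ω`. -/

def plus (s t : Tm o) : Tm o := Tm.add ⬝ s ⬝ t
def times (s t : Tm o) : Tm o := Tm.mul ⬝ s ⬝ t
def suc (s : Tm o) : Tm o := plus s .one

def Fml.le (s t : Tm o) : Fml := .or (.lt s t) (.eq s t)

/-- Equality of higher type: `x =_{σ ⇒ τ} y` is `∀ z^σ, x z =_τ y z`. -/
def eqAt : (σ : Ty) → Tm σ → Tm σ → Fml
  | .o, s, t => .eq s t
  | .arr σ τ, s, t => .all σ (eqAt τ (s.wk σ 1 ⬝ .var σ 0) (t.wk σ 1 ⬝ .var σ 0))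

/-- Kohlenbach's base theory: basic arithmetic, the defining equations of the combinators and of
the recursor, extensionality in all finite types, induction for quantifier-free formulas, and
the choice schema `QF-AC^{1,0}` for quantifier-free formulas. -/
inductive RCA0 : Set Fml
  | suc_ne_zero (s : Tm o) : RCA0 (.neg (.eq (suc s) .zero))
  | suc_inj (s t : Tm o) : RCA0 (.eq (suc s) (suc t) ⟹ .eq s t)
  | add_zero (s : Tm o) : RCA0 (.eq (plus s .zero) s)
  | add_suc (s t : Tm o) : RCA0 (.eq (plus s (suc t)) (suc (plus s t)))
  | mul_zero (s : Tm o) : RCA0 (.eq (times s .zero) .zero)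
  | mul_suc (s t : Tm o) : RCA0 (.eq (times s (suc t)) (plus (times s t) s))
  | not_lt_zero (s : Tm o) : RCA0 (.neg (.lt s .zero))
  | lt_suc (s t : Tm o) : RCA0 (.iff (.lt s (suc t)) (.le s t))
  | comK {ρ τ : Ty} (x : Tm ρ) (y : Tm τ) : RCA0 (eqAt ρ (Tm.comK ρ τ ⬝ x ⬝ y) x)
  | comS {δ ρ τ : Ty} (x : Tm (δ ⇒ ρ ⇒ τ)) (y : Tm (δ ⇒ ρ)) (z : Tm δ) :
      RCA0 (eqAt τ (Tm.comS δ ρ τ ⬝ x ⬝ y ⬝ z) (x ⬝ z ⬝ (y ⬝ z)))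
  | rec_zero (f : Tm (o ⇒ o ⇒ o)) (m : Tm o) : RCA0 (.eq (Tm.recO ⬝ f ⬝ m ⬝ .zero) m)
  | rec_suc (f : Tm (o ⇒ o ⇒ o)) (m n : Tm o) :
      RCA0 (.eq (Tm.recO ⬝ f ⬝ m ⬝ suc n) (f ⬝ n ⬝ (Tm.recO ⬝ f ⬝ m ⬝ n)))
  | extensionality {ρ τ : Ty} (x y : Tm ρ) (f : Tm (ρ ⇒ τ)) :
      RCA0 (eqAt ρ x y ⟹ eqAt τ (f ⬝ x) (f ⬝ y))
  /-- `φ(0) ∧ ∀ n (φ(n) → φ(n + 1)) → ∀ n φ(n)`, where `n` is the variable `0` of type `o`. -/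
  | induction (φ : Fml) : φ.QF →
      RCA0 (φ.inst Tm.zero ⟹
        .all o (φ ⟹ φ.subst (Sub.cons (suc (.var o 0)) (Sub.up o 1))) ⟹ .all o φ)
  /-- `∀ x^1 ∃ y^0 φ(x, y) → ∃ Y^2 ∀ x^1 φ(x, Y(x))`, where `x` and `y` are the variables `0` of
  type `1` and of type `o` in `φ`. -/
  | choice (φ : Fml) : φ.QF →
      RCA0 (.all t1 (.ex o φ) ⟹
        .ex t2 (.all t1 (φ.subst (Sub.cons (Tm.var t2 0 ⬝ Tm.var t1 0) (Sub.up t2 1)))))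

/-- The sentence `(∃²)`:
`∃ Φ^2 ≤ 1, ∀ f^1, (∃ n, f(n) = 0) ↔ Φ(f) = 0`. -/
def existsTwo : Fml :=
  .ex t2 (.and
    (.all t1 (.le (.var t2 0 ⬝ .var t1 0) .one))
    (.all t1 (.iff
      (.ex o (.eq (.var t1 0 ⬝ .var o 0) .zero))
      (.eq (.var t2 0 ⬝ .var t1 0) .zero))))

def ACA0 : Set Fml := insert existsTwo RCA0

/-! Real numbers, coded by fast-converging Cauchy sequences of rational numbers. -/

/-- The identity of type `1`. -/
def idT : Tm t1 := Tm.comS o t1 o ⬝ Tm.comK o t1 ⬝ Tm.comK o o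

/-- The closed term `λ n. 2 ^ n`, by the recursion `2 ^ 0 = 1`, `2 ^ (n + 1) = 2 ^ n + 2 ^ n`. -/
def pow2 : Tm t1 := Tm.recO ⬝ (Tm.comK t1 o ⬝ (Tm.comS o o o ⬝ Tm.add ⬝ idT)) ⬝ .one

/-- The pairing `(s, t) ↦ (s + t)² + s`, which is injective. -/
def pair (s t : Tm o) : Tm o := plus (times (plus s t) (plus s t)) s

/-- The code of the rational number `(a - b) / (d + 1)`. -/
def ratCode (a b d : Tm o) : Tm o := pair (pair a b) d

/-- `p` and `q` are codes of rational numbers with `p ≤ q + e / 2 ^ k`, that is,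
`∃ a b d a₁ b₁ d₁`, `p` codes `(a - b) / (d + 1)`, `q` codes `(a₁ - b₁) / (d₁ + 1)`, and
`2 ^ k (a (d₁ + 1) + b₁ (d + 1)) ≤ 2 ^ k (a₁ (d + 1) + b (d₁ + 1)) + e (d + 1) (d₁ + 1)`. -/
def ratLeAdd (p q e k : Tm o) : Fml :=
  let a : Tm o := .var o 5
  let b : Tm o := .var o 4
  let d : Tm o := .var o 3
  let a₁ : Tm o := .var o 2
  let b₁ : Tm o := .var o 1
  let d₁ : Tm o := .var o 0
  let N : Tm o := pow2 ⬝ k.wk o 6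
  .ex o (.ex o (.ex o (.ex o (.ex o (.ex o
    (.and (.eq (p.wk o 6) (ratCode a b d))
      (.and (.eq (q.wk o 6) (ratCode a₁ b₁ d₁))
        (.le
          (times N (plus (times a (suc d₁)) (times b₁ (suc d))))
          (plus (times N (plus (times a₁ (suc d)) (times b (suc d₁))))
            (times (e.wk o 6) (times (suc d) (suc d₁))))))))))))

/-- `x ∈ ℝ`: all `x(k)` code rational numbers, and `|x(k) - x(k + i)| ≤ 2 ^ (-k)` for all
`k` and `i`. -/
def inReal (x : Tm t1) : Fml :=
  let xk : Tm o := x.wk o 2 ⬝ .var o 1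
  let xki : Tm o := x.wk o 2 ⬝ plus (.var o 1) (.var o 0)
  .all o (.all o (.and (ratLeAdd xk xki .one (.var o 1)) (ratLeAdd xki xk .one (.var o 1))))

/-- `x ≤ y` as real numbers: `x(k) ≤ y(k) + 2 ^ (-k + 1)` for all `k`. -/
def leReal (x y : Tm t1) : Fml :=
  .all o (ratLeAdd (x.wk o 1 ⬝ .var o 0) (y.wk o 1 ⬝ .var o 0) (suc .one) (.var o 0))

/-- `x = y` as real numbers: `|x(k) - y(k)| ≤ 2 ^ (-k + 1)` for all `k`. -/
def eqReal (x y : Tm t1) : Fml := .and (leReal x y) (leReal y x)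

/-- The constant sequences of the rational numbers `0` and `1`. -/
def zeroReal : Tm t1 := Tm.comK o o ⬝ ratCode .zero .zero .zero
def oneReal : Tm t1 := Tm.comK o o ⬝ ratCode .one .zero .zero

/-- `x ∈ [0, 1]`. -/
def inUnit (x : Tm t1) : Fml := .and (inReal x) (.and (leReal zeroReal x) (leReal x oneReal))

/-- `f ∈ 2^ℕ`: `f(n) ≤ 1` for all `n`. -/
def inCantor (f : Tm t1) : Fml := .all o (.le (f.wk o 1 ⬝ .var o 0) .one)

/-- `f ∈ ℕ^ℕ`: no condition. -/
def inBaire (_ : Tm t1) : Fml := .neg .bot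

/-! The uncountability principles. -/

/-- There is no injection to the natural numbers from the space of the objects `x` of type `1`
with `D x`, where `E` is the equality of the space: there is no `Y` of type `2` such that
`E x y → Y(x) = Y(y)` (so that `Y` is a map on the space) and `Y(x) = Y(y) → E x y` (so that it is
injective) for all `x` and `y` with `D x` and `D y`. -/
def noInjection (D : Tm t1 → Fml) (E : Tm t1 → Tm t1 → Fml) : Fml :=
  let Y : Tm t2 := .var t2 0
  let x : Tm t1 := .var t1 1
  let y : Tm t1 := .var t1 0
  .neg (.ex t2 (.and
    (.all t1 (.all t1 (D x ⟹ D y ⟹ E x y ⟹ .eq (Y ⬝ x) (Y ⬝ y))))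
    (.all t1 (.all t1 (D x ⟹ D y ⟹ .eq (Y ⬝ x) (Y ⬝ y) ⟹ E x y)))))

/-- `NIN`: there is no injection from `[0, 1]` to `ℕ`. -/
def NIN : Fml := noInjection inUnit eqReal

/-- There is no injection from Cantor space `2^ℕ` to `ℕ`. -/
def NINCantor : Fml := noInjection inCantor (eqAt t1)

/-- There is no injection from Baire space `ℕ^ℕ` to `ℕ`. -/
def NINBaire : Fml := noInjection inBaire (eqAt t1)

/-- There is no injection from `ℝ` to `ℕ`. -/
def NINReal : Fml := noInjection inReal eqReal

end HORM

/-! Derivability is first reduced to truth. By Henkin completeness (`proves_of_valid`,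
`ACA0_proves`) it suffices to verify each equivalence in an arbitrary extensional model of the
axioms, where equality of higher type is genuine equality (`eval_eqAt`).

In such a model, `Injects.comap` pulls an injection to the numbers back along any object of type `t1
⇒ t1` that preserves and reflects the equalities of two spaces. So it is enough to map the four
spaces in a cycle. The unit interval is part of the line (`injects_unit`). A real goes to the
characteristic function of its set of rational upper bounds, in Baire space (`injects_real`). A
function goes to the characteristic function of its graph, in Cantor space (`injects_baire`). A
binary sequence goes to a sum in base 4, in the unit interval (`injects_cantor`). Every implication
between the principles is then a path in this cycle.

The functional of `(∃²)` serves the two characteristic functions, whose defining conditions quantify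
over the numbers. For the reals it does essential work: many Cauchy sequences represent one real,
and the set of upper bounds is a canonical representative, turning equality of reals into equality
of functions. In base 4 with digits 0 and 1, distinct sequences have sums a definite distance apart,
so no real is hit twice.

The model may be nonstandard and satisfies induction only for quantifier-free formulas. Hence the
ordered semiring of its numbers and the estimates for rationals are developed from
`QFPred.induction`, and the maps above are obtained as values of terms by bracket abstraction. -/

namespace HORM

open Ty

/-! Substitution calculus. -/

namespace Sub

variable {σ τ : Ty}

@[simp] theorem cons_zero (t : Tm σ) (s : Sub) : cons t s σ 0 = t := by simp [cons]

@[simp] theorem cons_succ (t : Tm σ) (s : Sub) (n : ℕ) : cons t s σ (n + 1) = s σ n := by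
  simp [cons]

theorem cons_ne (h : σ ≠ τ) (t : Tm σ) (s : Sub) (n : ℕ) : cons t s τ n = s τ n := by
  simp [cons, h]

@[simp] theorem up_self (m n : ℕ) : up σ m σ n = .var σ (n + m) := by simp [up]

theorem up_ne (h : σ ≠ τ) (m n : ℕ) : up σ m τ n = .var τ n := by simp [up, h.symm]

/-- The substitution `s` followed by `r`. -/
def comp (s r : Sub) : Sub := fun σ n => (s σ n).subst r

theorem ext_cases {s r : Sub} (σ : Ty) (h₀ : s σ 0 = r σ 0)
    (h₁ : ∀ n, s σ (n + 1) = r σ (n + 1)) (h₂ : ∀ τ n, σ ≠ τ → s τ n = r τ n) : s = r := by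
  funext τ n
  by_cases h : σ = τ
  · subst h
    cases n
    · exact h₀
    · exact h₁ _
  · exact h₂ τ n h

theorem up_comp_cons (t : Tm σ) (s : Sub) : (up σ 1).comp (cons t s) = s := by
  funext τ n
  by_cases h : σ = τ
  · subst h
    simp [comp, Tm.subst]
  · simp [comp, up_ne h, Tm.subst, cons_ne h]

end Sub

theorem Tm.subst_subst (s r : Sub) {σ : Ty} (t : Tm σ) :
    (t.subst s).subst r = t.subst (s.comp r) := by
  induction t <;> simp_all [Tm.subst, Sub.comp]

@[simp] theorem Tm.subst_var {σ : Ty} (t : Tm σ) : t.subst Tm.var = t := by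
  induction t <;> simp_all [Tm.subst]

theorem Tm.wk_subst_cons {σ τ : Ty} (u : Tm τ) (t : Tm σ) (s : Sub) :
    (u.wk σ 1).subst (Sub.cons t s) = u.subst s := by
  rw [Tm.wk, Tm.subst_subst, Sub.up_comp_cons]

theorem Tm.wk_subst_lift {σ τ : Ty} (u : Tm τ) (s : Sub) :
    (u.wk σ 1).subst (s.lift σ) = (u.subst s).wk σ 1 := by
  rw [Sub.lift, Tm.wk_subst_cons, Tm.wk, Tm.subst_subst]
  rfl

namespace Sub

variable {σ τ : Ty}

@[simp] theorem lift_zero (s : Sub) : s.lift σ σ 0 = .var σ 0 := by simp [lift]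

@[simp] theorem lift_succ (s : Sub) (n : ℕ) : s.lift σ σ (n + 1) = (s σ n).wk σ 1 := by
  simp [lift]

theorem lift_ne (h : σ ≠ τ) (s : Sub) (n : ℕ) : s.lift σ τ n = (s τ n).wk σ 1 := by
  simp [lift, cons_ne h]

theorem lift_comp_lift (s r : Sub) : (s.lift σ).comp (r.lift σ) = (s.comp r).lift σ := by
  refine ext_cases σ ?_ (fun n => ?_) fun τ n h => ?_
  · simp [comp, Tm.subst]
  · simp [comp, Tm.wk_subst_lift]
  · simp [comp, lift_ne h, Tm.wk_subst_lift]

theorem lift_comp_cons (s r : Sub) (t : Tm σ) : (s.lift σ).comp (cons t r) = cons t (s.comp r) := by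
  refine ext_cases σ ?_ (fun n => ?_) fun τ n h => ?_
  · simp [comp, Tm.subst]
  · simp [comp, Tm.wk_subst_cons]
  · simp [comp, lift_ne h, cons_ne h, Tm.wk_subst_cons]

theorem cons_comp (s r : Sub) (t : Tm σ) : (cons t s).comp r = cons (t.subst r) (s.comp r) := by
  refine ext_cases σ ?_ (fun n => ?_) fun τ n h => ?_
  · simp [comp]
  · simp [comp]
  · simp [comp, cons_ne h]

theorem lift_var : Sub.lift σ Tm.var = Tm.var := by
  refine ext_cases σ ?_ (fun n => ?_) fun τ n h => ?_
  · simp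
  · simp [Tm.wk, Tm.subst]
  · simp [lift_ne h, Tm.wk, Tm.subst, up_ne h]

@[simp] theorem comp_var (s : Sub) : s.comp Tm.var = s := by
  funext τ n
  simp [comp]

@[simp] theorem var_comp (s : Sub) : Sub.comp Tm.var s = s := by
  funext τ n
  simp [comp, Tm.subst]

theorem up_comp_lift (s : Sub) : (up σ 1).comp (s.lift σ) = s.comp (up σ 1) :=
  up_comp_cons _ _

end Sub

namespace Fml

variable {σ τ : Ty}

theorem subst_subst (φ : Fml) (s r : Sub) : (φ.subst s).subst r = φ.subst (s.comp r) := by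
  induction φ generalizing s r with
  | eq a b => simp [Fml.subst, Tm.subst_subst]
  | lt a b => simp [Fml.subst, Tm.subst_subst]
  | bot => rfl
  | imp φ ψ ih₁ ih₂ => simp [Fml.subst, ih₁, ih₂]
  | all σ φ ih => simp [Fml.subst, ih, Sub.lift_comp_lift]

@[simp] theorem subst_var (φ : Fml) : φ.subst Tm.var = φ := by
  induction φ with
  | eq a b => simp [Fml.subst]
  | lt a b => simp [Fml.subst]
  | bot => rfl
  | imp φ ψ ih₁ ih₂ => simp [Fml.subst, ih₁, ih₂]
  | all σ φ ih => simp [Fml.subst, ih, Sub.lift_var]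

theorem subst_lift_inst (φ : Fml) (s : Sub) (t : Tm σ) :
    (φ.subst (s.lift σ)).inst t = φ.subst (Sub.cons t s) := by
  rw [inst, subst_subst, Sub.lift_comp_cons, Sub.comp_var]

theorem inst_subst (φ : Fml) (s : Sub) (t : Tm σ) :
    (φ.inst t).subst s = (φ.subst (s.lift σ)).inst (t.subst s) := by
  rw [subst_lift_inst, inst, subst_subst, Sub.cons_comp, Sub.var_comp]

theorem wk_subst_lift (φ : Fml) (s : Sub) :
    (φ.wk σ).subst (s.lift σ) = (φ.subst s).wk σ := by
  rw [wk, wk, subst_subst, subst_subst, Sub.up_comp_lift]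

theorem QF.subst {φ : Fml} (h : φ.QF) (s : Sub) : (φ.subst s).QF := by
  induction φ generalizing s with
  | eq a b => trivial
  | lt a b => trivial
  | bot => trivial
  | imp φ ψ ih₁ ih₂ => exact ⟨ih₁ h.1 s, ih₂ h.2 s⟩
  | all σ φ ih => exact h.elim

/-- For every formula there is a bound on the indices of its free variables. -/
theorem exists_bound (φ : Fml) : ∃ b : ℕ, ∀ s r : Sub,
    (∀ σ n, n < b → s σ n = r σ n) → φ.subst s = φ.subst r := by
  have tm : ∀ {σ : Ty} (t : Tm σ), ∃ b : ℕ, ∀ s r : Sub,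
      (∀ σ n, n < b → s σ n = r σ n) → t.subst s = t.subst r := by
    intro σ t
    induction t with
    | var σ n => exact ⟨n + 1, fun s r h => h σ n (Nat.lt_succ_self n)⟩
    | app f a ihf iha =>
      obtain ⟨b, hb⟩ := ihf
      obtain ⟨c, hc⟩ := iha
      refine ⟨max b c, fun s r h => ?_⟩
      rw [Tm.subst, Tm.subst, hb s r fun σ n hn => h σ n (lt_max_of_lt_left hn),
        hc s r fun σ n hn => h σ n (lt_max_of_lt_right hn)]
    | _ => exact ⟨0, fun _ _ _ => rfl⟩
  induction φ with
  | eq a b =>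
    obtain ⟨c, hc⟩ := tm a
    obtain ⟨d, hd⟩ := tm b
    refine ⟨max c d, fun s r h => ?_⟩
    rw [Fml.subst, Fml.subst, hc s r fun σ n hn => h σ n (lt_max_of_lt_left hn),
      hd s r fun σ n hn => h σ n (lt_max_of_lt_right hn)]
  | lt a b =>
    obtain ⟨c, hc⟩ := tm a
    obtain ⟨d, hd⟩ := tm b
    refine ⟨max c d, fun s r h => ?_⟩
    rw [Fml.subst, Fml.subst, hc s r fun σ n hn => h σ n (lt_max_of_lt_left hn),
      hd s r fun σ n hn => h σ n (lt_max_of_lt_right hn)]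
  | bot => exact ⟨0, fun _ _ _ => rfl⟩
  | imp φ ψ ih₁ ih₂ =>
    obtain ⟨c, hc⟩ := ih₁
    obtain ⟨d, hd⟩ := ih₂
    refine ⟨max c d, fun s r h => ?_⟩
    rw [Fml.subst, Fml.subst, hc s r fun σ n hn => h σ n (lt_max_of_lt_left hn),
      hd s r fun σ n hn => h σ n (lt_max_of_lt_right hn)]
  | all σ φ ih =>
    obtain ⟨b, hb⟩ := ih
    -- The bound need not grow: below a binder over `σ`, an index `n + 1` of type `σ` reads the
    -- substitution at `n`, and the other types keep their indices.
    refine ⟨b, fun s r h => ?_⟩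
    rw [Fml.subst, Fml.subst, hb (s.lift σ) (r.lift σ)]
    intro τ n hn
    by_cases e : σ = τ
    · subst e
      cases n with
      | zero => simp
      | succ n => simp [h σ n (by omega)]
    · simp [Sub.lift_ne e, h τ n hn]

theorem exists_list_bound (Δ : List Fml) : ∃ b : ℕ, ∀ φ ∈ Δ, ∀ s r : Sub,
    (∀ σ n, n < b → s σ n = r σ n) → φ.subst s = φ.subst r := by
  induction Δ with
  | nil => exact ⟨0, by simp⟩
  | cons ψ Δ ih =>
    obtain ⟨b, hb⟩ := ih
    obtain ⟨c, hc⟩ := ψ.exists_bound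
    refine ⟨max b c, fun φ hφ s r h => ?_⟩
    rcases List.mem_cons.1 hφ with rfl | hφ
    · exact hc s r fun σ n hn => h σ n (lt_max_of_lt_right hn)
    · exact hb φ hφ s r fun σ n hn => h σ n (lt_max_of_lt_left hn)

end Fml

theorem eqAt_subst {σ : Ty} (s t : Tm σ) (r : Sub) :
    (eqAt σ s t).subst r = eqAt σ (s.subst r) (t.subst r) := by
  induction σ generalizing r with
  | o => rfl
  | arr σ τ _ ih => simp [eqAt, Fml.subst, ih, Tm.subst, Tm.wk_subst_lift]

/-- The axioms are schematic in their terms, so a substitution only changes the instance. Induction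
and choice need more, since the inner substitution of each schema must commute with one lifted under
its binders. -/
theorem RCA0.subst {φ : Fml} (h : RCA0 φ) (s : Sub) : RCA0 (φ.subst s) := by
  cases h with
  | suc_ne_zero a => exact .suc_ne_zero (a.subst s)
  | suc_inj a b => exact .suc_inj (a.subst s) (b.subst s)
  | add_zero a => exact .add_zero (a.subst s)
  | add_suc a b => exact .add_suc (a.subst s) (b.subst s)
  | mul_zero a => exact .mul_zero (a.subst s)
  | mul_suc a b => exact .mul_suc (a.subst s) (b.subst s)
  | not_lt_zero a => exact .not_lt_zero (a.subst s)
  | lt_suc a b => exact .lt_suc (a.subst s) (b.subst s)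
  | comK x y =>
    rw [eqAt_subst]
    exact .comK (x.subst s) (y.subst s)
  | comS x y z =>
    rw [eqAt_subst]
    exact .comS (x.subst s) (y.subst s) (z.subst s)
  | rec_zero f m => exact .rec_zero (f.subst s) (m.subst s)
  | rec_suc f m n => exact .rec_suc (f.subst s) (m.subst s) (n.subst s)
  | extensionality x y f =>
    rw [Fml.subst, eqAt_subst, eqAt_subst]
    exact .extensionality (x.subst s) (y.subst s) (f.subst s)
  | induction φ hφ =>
    have key : (φ.subst (Sub.cons (suc (.var o 0)) (Sub.up o 1))).subst (s.lift o) =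
        (φ.subst (s.lift o)).subst (Sub.cons (suc (.var o 0)) (Sub.up o 1)) := by
      rw [Fml.subst_subst, Fml.subst_subst, Sub.cons_comp, Sub.lift_comp_cons, Sub.up_comp_lift]
      simp [suc, plus, Tm.subst]
    simp only [Fml.subst, Fml.inst_subst, key]
    exact .induction _ (hφ.subst _)
  | choice φ hφ =>
    have key : (φ.subst (Sub.cons (Tm.var t2 0 ⬝ Tm.var t1 0) (Sub.up t2 1))).subst
          ((s.lift t2).lift t1) =
        (φ.subst ((s.lift t1).lift o)).subst
          (Sub.cons (Tm.var t2 0 ⬝ Tm.var t1 0) (Sub.up t2 1)) := by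
      rw [Fml.subst_subst, Fml.subst_subst, Sub.cons_comp, Sub.lift_comp_cons]
      have h12 : t1 ≠ t2 := by decide
      congr 2
      · have aux : ∀ {τ : Ty} (u : Tm τ), (u.wk t2 1).wk t1 1 = (u.wk t1 1).subst (Sub.up t2 1) := by
          intro τ u
          simp only [Tm.wk, Tm.subst_subst]
          congr 1
          funext τ n
          simp only [Sub.comp, Sub.up, Tm.subst]
          by_cases h : τ = t1 <;> by_cases h' : τ = t2 <;> simp [h, h']
        refine Sub.ext_cases t1 ?_ (fun n => ?_) fun τ n h => ?_
        · simp [Sub.comp, Tm.subst, Sub.up_ne h12.symm]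
        · simp [Sub.comp, Tm.subst, Sub.up_ne h12.symm, Sub.lift_ne h12.symm, aux]
        · by_cases h' : t2 = τ
          · subst h'
            simp [Sub.comp, Tm.subst, Sub.lift_ne h12, aux]
          · simp [Sub.comp, Tm.subst, Sub.lift_ne h, Sub.up_ne h', Sub.lift_ne h', aux]
    simp only [Fml.ex, Fml.neg, Fml.subst, key]
    exact .choice _ (hφ.subst _)

/-- The added axiom `existsTwo` is closed, hence fixed by substitution. -/
theorem ACA0.subst {φ : Fml} (h : φ ∈ ACA0) (s : Sub) : φ.subst s ∈ ACA0 := by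
  rcases h with rfl | h
  · left
    have h12 : t1 ≠ t2 := by decide
    have h10 : o ≠ t1 := by decide
    have h02 : o ≠ t2 := by decide
    simp [existsTwo, Fml.subst, Fml.ex, Fml.and, Fml.neg, Fml.iff, Fml.le, Fml.or, Tm.subst,
      Sub.lift_ne h12, Sub.lift_ne h10, Tm.wk, Sub.up_ne h12, Sub.up_ne h10]
  · exact .inr (RCA0.subst h s)

/-! Derivations. -/

namespace Prf

variable {T : Set Fml}

theorem weaken {Δ Δ' : List Fml} {φ : Fml} (h : Prf T Δ φ) (hΔ : Δ ⊆ Δ') : Prf T Δ' φ := by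
  induction h generalizing Δ' with
  | theory h => exact .theory h
  | hyp h => exact .hyp (hΔ h)
  | impI _ ih => exact .impI (ih (List.cons_subset_cons _ hΔ))
  | impE _ _ ih₁ ih₂ => exact .impE (ih₁ hΔ) (ih₂ hΔ)
  | raa _ ih => exact .raa (ih (List.cons_subset_cons _ hΔ))
  | allI _ ih => exact .allI (ih (List.map_subset _ hΔ))
  | allE t _ ih => exact .allE t (ih hΔ)
  | eqRefl t => exact .eqRefl t
  | eqSubst φ _ _ ih₁ ih₂ => exact .eqSubst φ (ih₁ hΔ) (ih₂ hΔ)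

theorem subst (hT : ∀ φ ∈ T, ∀ s, φ.subst s ∈ T) {Δ : List Fml} {φ : Fml} (h : Prf T Δ φ)
    (s : Sub) : Prf T (Δ.map (Fml.subst s)) (φ.subst s) := by
  induction h generalizing s with
  | theory h => exact .theory (hT _ h s)
  | hyp h => exact .hyp (List.mem_map_of_mem h)
  | impI _ ih => exact .impI (ih s)
  | impE _ _ ih₁ ih₂ => exact .impE (ih₁ s) (ih₂ s)
  | raa _ ih => exact .raa (ih s)
  | @allI Δ σ φ _ ih =>
    refine .allI ?_
    have e : (Δ.map (Fml.wk σ)).map (Fml.subst (s.lift σ)) =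
        (Δ.map (Fml.subst s)).map (Fml.wk σ) := by
      simp [Fml.wk_subst_lift]
    rw [← e]
    exact ih (s.lift σ)
  | allE t _ ih =>
    rw [Fml.inst_subst]
    exact .allE _ (ih s)
  | eqRefl t => exact .eqRefl _
  | eqSubst φ _ _ ih₁ ih₂ =>
    have h₂ := ih₂ s
    rw [Fml.inst_subst] at h₂ ⊢
    exact .eqSubst _ (ih₁ s) h₂

theorem cut {Δ : List Fml} {φ ψ : Fml} (h₁ : Prf T Δ φ) (h₂ : Prf T (φ :: Δ) ψ) : Prf T Δ ψ :=
  .impE (.impI h₂) h₁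

theorem exfalso {Δ : List Fml} (h : Prf T Δ .bot) (φ : Fml) : Prf T Δ φ :=
  .raa (h.weaken (List.subset_cons_self _ _))

/-- Adding a witness for a negated universal formula is conservative. -/
theorem elim_witness (hT : ∀ φ ∈ T, ∀ s, φ.subst s ∈ T) {Δ : List Fml} {σ : Ty} {χ : Fml} {m : ℕ}
    (hΔ : ∀ φ ∈ Δ, ∀ s r : Sub, (∀ σ n, n < m → s σ n = r σ n) → φ.subst s = φ.subst r)
    (hχ : ∀ s r : Sub, (∀ σ n, n < m → s σ n = r σ n) → χ.subst s = χ.subst r)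
    (h : Prf T ((χ.inst (.var σ m)).neg :: Δ) .bot) : Prf T Δ (.all σ χ) := by
  refine .allI ?_
  -- The variable `m` is fresh for `Δ` and `χ`, so renaming it to the newly bound variable `0` and
  -- shifting the rest weakens `Δ` and turns the instance of `χ` at `m` back into `χ`.
  let r : Sub := fun τ n => if τ = σ ∧ n = m then .var τ 0 else Sub.up σ 1 τ n
  have hr : ∀ τ n, n < m → r τ n = Sub.up σ 1 τ n := fun τ n hn => by simp [r, hn.ne]
  have h₁ := h.raa.subst hT r
  have e₁ : Δ.map (Fml.subst r) = Δ.map (Fml.wk σ) :=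
    List.map_congr_left fun φ hφ => hΔ φ hφ _ _ hr
  have e₂ : (χ.inst (.var σ m)).subst r = χ := by
    rw [Fml.inst, Fml.subst_subst]
    conv_rhs => rw [← χ.subst_var]
    refine hχ _ _ fun τ n hn => ?_
    by_cases e : σ = τ
    · subst e
      cases n with
      | zero => simp [Sub.comp, Tm.subst, r]
      | succ n => simp [Sub.comp, Tm.subst, r, show n ≠ m by omega]
    · simp [Sub.comp, Tm.subst, Sub.cons_ne e, r, Sub.up_ne e, Ne.symm e]
  rwa [e₁, e₂] at h₁

end Prf

end HORM

/-! ### Semantics and the Henkin completeness theorem. -/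

namespace HORM

open Ty

/-! The set of formulas is countable. -/

/-- Binary trees with natural numbers at the leaves, as codes of types, terms and formulas. -/
inductive Code : Type
  | leaf (n : ℕ) : Code
  | node (a b : Code) : Code
  deriving Encodable

namespace Code

/-- The type with a given code. -/
def toTy : Code → Ty
  | leaf _ => o
  | node a b => a.toTy ⇒ b.toTy

/-- The term with a given code. -/
def toTm : Code → Σ σ, Tm σ
  | leaf 0 => ⟨_, .zero⟩
  | leaf 1 => ⟨_, .one⟩
  | leaf 2 => ⟨_, .add⟩
  | leaf 3 => ⟨_, .mul⟩
  | leaf _ => ⟨_, .recO⟩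
  | node (leaf 0) (node a (leaf n)) => ⟨_, .var a.toTy n⟩
  | node (leaf 1) (node a b) => ⟨_, .comK a.toTy b.toTy⟩
  | node (leaf 2) (node a (node b c)) => ⟨_, .comS a.toTy b.toTy c.toTy⟩
  | node (leaf _) (node f a) =>
    match f.toTm, a.toTm with
    | ⟨.arr σ _, f⟩, ⟨σ', a⟩ => if h : σ' = σ then ⟨_, .app f (h ▸ a)⟩ else ⟨_, .zero⟩
    | _, _ => ⟨_, .zero⟩
  | _ => ⟨_, .zero⟩

/-- The formula with a given code. -/
def toFml : Code → Fml
  | node (leaf 0) (node a b) =>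
    match a.toTm, b.toTm with
    | ⟨.o, s⟩, ⟨.o, t⟩ => .eq s t
    | _, _ => .bot
  | node (leaf 1) (node a b) =>
    match a.toTm, b.toTm with
    | ⟨.o, s⟩, ⟨.o, t⟩ => .lt s t
    | _, _ => .bot
  | node (leaf 2) (node a b) => a.toFml ⟹ b.toFml
  | node (leaf _) (node a b) => .all a.toTy b.toFml
  | _ => .bot

theorem toTy_surjective : Function.Surjective toTy := fun σ => by
  induction σ with
  | o => exact ⟨leaf 0, rfl⟩
  | arr σ τ ih₁ ih₂ =>
    obtain ⟨a, rfl⟩ := ih₁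
    obtain ⟨b, rfl⟩ := ih₂
    exact ⟨node a b, rfl⟩

theorem exists_toTm {σ : Ty} (t : Tm σ) : ∃ c : Code, c.toTm = ⟨σ, t⟩ := by
  induction t with
  | var σ n =>
    obtain ⟨a, rfl⟩ := toTy_surjective σ
    exact ⟨node (leaf 0) (node a (leaf n)), rfl⟩
  | zero => exact ⟨leaf 0, rfl⟩
  | one => exact ⟨leaf 1, rfl⟩
  | add => exact ⟨leaf 2, rfl⟩
  | mul => exact ⟨leaf 3, rfl⟩
  | comK ρ τ =>
    obtain ⟨a, rfl⟩ := toTy_surjective ρ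
    obtain ⟨b, rfl⟩ := toTy_surjective τ
    exact ⟨node (leaf 1) (node a b), rfl⟩
  | comS δ ρ τ =>
    obtain ⟨a, rfl⟩ := toTy_surjective δ
    obtain ⟨b, rfl⟩ := toTy_surjective ρ
    obtain ⟨c, rfl⟩ := toTy_surjective τ
    exact ⟨node (leaf 2) (node a (node b c)), rfl⟩
  | recO => exact ⟨leaf 4, rfl⟩
  | app f a ihf iha =>
    obtain ⟨c, hc⟩ := ihf
    obtain ⟨d, hd⟩ := iha
    exact ⟨node (leaf 3) (node c d), by simp [toTm, hc, hd]⟩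

theorem toFml_surjective : Function.Surjective toFml := fun φ => by
  induction φ with
  | eq s t =>
    obtain ⟨a, ha⟩ := exists_toTm s
    obtain ⟨b, hb⟩ := exists_toTm t
    exact ⟨node (leaf 0) (node a b), by simp [toFml, ha, hb]⟩
  | lt s t =>
    obtain ⟨a, ha⟩ := exists_toTm s
    obtain ⟨b, hb⟩ := exists_toTm t
    exact ⟨node (leaf 1) (node a b), by simp [toFml, ha, hb]⟩
  | bot => exact ⟨leaf 0, rfl⟩
  | imp φ ψ ih₁ ih₂ =>
    obtain ⟨a, rfl⟩ := ih₁
    obtain ⟨b, rfl⟩ := ih₂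
    exact ⟨node (leaf 2) (node a b), rfl⟩
  | all σ φ ih =>
    obtain ⟨a, rfl⟩ := toTy_surjective σ
    obtain ⟨b, rfl⟩ := ih
    exact ⟨node (leaf 3) (node a b), rfl⟩

end Code

/-- Only a surjection from codes is needed, so ill-typed codes may decode to anything. Countability
lets the Henkin construction treat the formulas one by one. -/
instance : Countable Fml := Code.toFml_surjective.countable

/-! Models. -/

/-- Extensional structures for the language. -/
structure Model where
  C : Ty → Type
  app : ∀ {σ τ : Ty}, C (σ ⇒ τ) → C σ → C τ
  ext : ∀ {σ τ : Ty} (f g : C (σ ⇒ τ)), (∀ x, app f x = app g x) → f = g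
  zero : C o
  one : C o
  add : C (o ⇒ o ⇒ o)
  mul : C (o ⇒ o ⇒ o)
  comK : ∀ ρ τ : Ty, C (ρ ⇒ τ ⇒ ρ)
  comS : ∀ δ ρ τ : Ty, C ((δ ⇒ ρ ⇒ τ) ⇒ (δ ⇒ ρ) ⇒ δ ⇒ τ)
  recO : C ((o ⇒ o ⇒ o) ⇒ o ⇒ o ⇒ o)
  lt : C o → C o → Prop

namespace Model

variable (M : Model)

/-- Assignments of objects to the variables. -/
abbrev Env : Type := (σ : Ty) → ℕ → M.C σ

variable {M}

/-- The assignment below a quantifier. -/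
def Env.cons {σ : Ty} (x : M.C σ) (e : M.Env) : M.Env := fun τ n =>
  if h : σ = τ then
    match n with
    | 0 => h ▸ x
    | n + 1 => e τ n
  else e τ n

@[simp] theorem Env.cons_zero {σ : Ty} (x : M.C σ) (e : M.Env) : Env.cons x e σ 0 = x := by
  simp [Env.cons]

@[simp] theorem Env.cons_succ {σ : Ty} (x : M.C σ) (e : M.Env) (n : ℕ) :
    Env.cons x e σ (n + 1) = e σ n := by
  simp [Env.cons]

theorem Env.cons_ne {σ τ : Ty} (h : σ ≠ τ) (x : M.C σ) (e : M.Env) (n : ℕ) :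
    Env.cons x e τ n = e τ n := by
  simp [Env.cons, h]

end Model

/-- The value of a term. -/
def Tm.eval {M : Model} (e : M.Env) : {σ : Ty} → Tm σ → M.C σ
  | _, .var σ n => e σ n
  | _, .zero => M.zero
  | _, .one => M.one
  | _, .add => M.add
  | _, .mul => M.mul
  | _, .comK ρ τ => M.comK ρ τ
  | _, .comS δ ρ τ => M.comS δ ρ τ
  | _, .recO => M.recO
  | _, .app f a => M.app (f.eval e) (a.eval e)

/-- Truth of a formula. -/
def Fml.eval {M : Model} : M.Env → Fml → Prop
  | e, .eq s t => s.eval e = t.eval e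
  | e, .lt s t => M.lt (s.eval e) (t.eval e)
  | _, .bot => False
  | e, .imp φ ψ => φ.eval e → ψ.eval e
  | e, .all σ φ => ∀ x : M.C σ, φ.eval (Model.Env.cons x e)

open Model

variable {M : Model}

theorem Tm.eval_subst (s : Sub) (e : M.Env) {σ : Ty} (t : Tm σ) :
    (t.subst s).eval e = t.eval fun τ n => (s τ n).eval e := by
  induction t <;> simp_all [Tm.subst, Tm.eval]

theorem Model.Env.eval_up {σ : Ty} (x : M.C σ) (e : M.Env) :
    (fun τ n => (Sub.up σ 1 τ n).eval (Env.cons x e)) = e := by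
  funext τ n
  by_cases h : σ = τ
  · subst h
    simp [Tm.eval]
  · simp [Tm.eval, Sub.up_ne h, Env.cons_ne h]

@[simp] theorem Tm.eval_wk {σ τ : Ty} (x : M.C σ) (e : M.Env) (t : Tm τ) :
    (t.wk σ 1).eval (Env.cons x e) = t.eval e := by
  rw [Tm.wk, Tm.eval_subst, Env.eval_up]

theorem Tm.wk_add_one (σ : Ty) (m : ℕ) {τ : Ty} (t : Tm τ) :
    t.wk σ (m + 1) = (t.wk σ m).wk σ 1 := by
  rw [Tm.wk, Tm.wk, Tm.wk, Tm.subst_subst]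
  congr 1
  funext τ n
  by_cases h : σ = τ
  · subst h
    simp [Sub.comp, Tm.subst, add_assoc]
  · simp [Sub.comp, Tm.subst, Sub.up_ne h]

@[simp] theorem Tm.eval_wk_add_one {σ τ : Ty} (m : ℕ) (x : M.C σ) (e : M.Env) (t : Tm τ) :
    (t.wk σ (m + 1)).eval (Env.cons x e) = (t.wk σ m).eval e := by
  rw [Tm.wk_add_one, Tm.eval_wk]

theorem Model.Env.eval_cons {σ : Ty} (t : Tm σ) (s : Sub) (e : M.Env) :
    (fun τ n => (Sub.cons t s τ n).eval e) =
      Env.cons (t.eval e) fun τ n => (s τ n).eval e := by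
  funext τ n
  by_cases h : σ = τ
  · subst h
    cases n <;> simp
  · simp [Sub.cons_ne h, Env.cons_ne h]

theorem Fml.eval_subst (s : Sub) (e : M.Env) (φ : Fml) :
    (φ.subst s).eval e ↔ φ.eval fun τ n => (s τ n).eval e := by
  induction φ generalizing s e with
  | eq a b => simp [Fml.subst, Fml.eval, Tm.eval_subst]
  | lt a b => simp [Fml.subst, Fml.eval, Tm.eval_subst]
  | bot => rfl
  | imp φ ψ ih₁ ih₂ => simp [Fml.subst, Fml.eval, ih₁, ih₂]
  | all σ φ ih =>
    simp only [Fml.subst, Fml.eval, ih, Sub.lift, Env.eval_cons, Tm.eval_wk]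
    simp [Tm.eval]

theorem Fml.eval_inst {σ : Ty} (t : Tm σ) (e : M.Env) (φ : Fml) :
    (φ.inst t).eval e ↔ φ.eval (Env.cons (t.eval e) e) := by
  rw [Fml.inst, Fml.eval_subst, Env.eval_cons]
  rfl

section connectives

variable (e : M.Env) (φ ψ : Fml)

@[simp] theorem Fml.eval_eq (s t : Tm o) : (Fml.eq s t).eval e ↔ s.eval e = t.eval e := Iff.rfl

@[simp] theorem Fml.eval_lt (s t : Tm o) :
    (Fml.lt s t).eval e ↔ M.lt (s.eval e) (t.eval e) := Iff.rfl

@[simp] theorem Fml.eval_bot : Fml.bot.eval e ↔ False := Iff.rfl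

@[simp] theorem Fml.eval_imp : (φ ⟹ ψ).eval e ↔ (φ.eval e → ψ.eval e) := Iff.rfl

@[simp] theorem Fml.eval_all (σ : Ty) :
    (Fml.all σ φ).eval e ↔ ∀ x : M.C σ, φ.eval (Env.cons x e) := Iff.rfl

@[simp] theorem Fml.eval_neg : φ.neg.eval e ↔ ¬ φ.eval e := Iff.rfl

@[simp] theorem Fml.eval_and : (φ.and ψ).eval e ↔ φ.eval e ∧ ψ.eval e := by
  simp [Fml.and]

@[simp] theorem Fml.eval_or : (φ.or ψ).eval e ↔ φ.eval e ∨ ψ.eval e := by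
  simp [Fml.or]
  tauto

@[simp] theorem Fml.eval_iff : (φ.iff ψ).eval e ↔ (φ.eval e ↔ ψ.eval e) := by
  simp [Fml.iff]
  tauto

@[simp] theorem Fml.eval_ex (σ : Ty) :
    (Fml.ex σ φ).eval e ↔ ∃ x : M.C σ, φ.eval (Env.cons x e) := by
  simp [Fml.ex]

@[simp] theorem Fml.eval_le (s t : Tm o) :
    (Fml.le s t).eval e ↔ M.lt (s.eval e) (t.eval e) ∨ s.eval e = t.eval e := by
  simp [Fml.le]

-- Extensionality of the structure, applied at each arrow type, collapses the defined pointwise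
-- equality to identity of objects.
@[simp] theorem eval_eqAt {σ : Ty} (s t : Tm σ) :
    (eqAt σ s t).eval e ↔ s.eval e = t.eval e := by
  induction σ generalizing e with
  | o => rfl
  | arr σ τ _ ih =>
    simp only [eqAt, Fml.eval_all, ih]
    simp only [Tm.eval, Tm.eval_wk, Env.cons_zero]
    exact ⟨M.ext _ _, fun h x => by rw [h]⟩

end connectives

/-- All formulas of `T` are valid in `M`. -/
def Model.Sat (M : Model) (T : Set Fml) : Prop := ∀ φ ∈ T, ∀ e : M.Env, φ.eval e

/-! Completeness. -/

/-- Consistent finite sets of formulas. -/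
def Consistent (T : Set Fml) (Δ : List Fml) : Prop := ¬ Prf T Δ .bot

/-- A set of formulas that is closed under derivations from `T`, is maximal consistent, and has
witnesses for its negated universal formulas. -/
structure Henkin (T : Set Fml) (Γ : Set Fml) : Prop where
  closed : ∀ {Δ φ}, (∀ ψ ∈ Δ, ψ ∈ Γ) → Prf T Δ φ → φ ∈ Γ
  bot : Fml.bot ∉ Γ
  mem_or : ∀ φ, φ ∈ Γ ∨ φ.neg ∈ Γ
  witness : ∀ {σ φ}, (∀ t : Tm σ, φ.inst t ∈ Γ) → Fml.all σ φ ∈ Γ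

/-- One stage of the Henkin construction. Each stage is a finite list, so a variable beyond all its
indices can serve as the witness, and the language needs no new constants. -/
theorem Consistent.exists_step {T : Set Fml} (hT : ∀ φ ∈ T, ∀ s, φ.subst s ∈ T) {Δ : List Fml}
    (h : Consistent T Δ) (φ : Fml) : ∃ Δ', Consistent T Δ' ∧ Δ ⊆ Δ' ∧ (φ ∈ Δ' ∨ φ.neg ∈ Δ') ∧
      ∀ σ χ, φ = .all σ χ → φ ∈ Δ' ∨ ∃ t : Tm σ, (χ.inst t).neg ∈ Δ' := by
  by_cases h₁ : Consistent T (φ :: Δ)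
  · exact ⟨φ :: Δ, h₁, List.subset_cons_self _ _, .inl (by simp), fun _ _ _ => .inl (by simp)⟩
  have h₂ : Consistent T (φ.neg :: Δ) := fun h₂ => h (.cut h₂.raa (not_not.1 h₁))
  by_cases hφ : ∃ σ χ, φ = .all σ χ
  · obtain ⟨σ, χ, rfl⟩ := hφ
    obtain ⟨m, hm⟩ := Fml.exists_list_bound (χ :: (Fml.all σ χ).neg :: Δ)
    refine ⟨(χ.inst (.var σ m)).neg :: (Fml.all σ χ).neg :: Δ, fun h₃ => h₂ ?_, by simp,
      .inr (by simp), ?_⟩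
    · exact .impE (.hyp List.mem_cons_self) (Prf.elim_witness hT
        (fun φ hφ => hm φ (List.mem_cons_of_mem _ hφ)) (hm χ (by simp)) h₃)
    · rintro σ' χ' ⟨⟩
      exact .inr ⟨.var σ m, by simp⟩
  · exact ⟨φ.neg :: Δ, h₂, List.subset_cons_self _ _, .inr (by simp),
      fun σ χ e => (hφ ⟨σ, χ, e⟩).elim⟩

/-- The Henkin set is the union of an increasing chain of finite stages that decide the formulas in
turn. A derivation has finitely many assumptions, all present at one stage, so consistency passes to
the union. -/
theorem Consistent.exists_henkin {T : Set Fml} (hT : ∀ φ ∈ T, ∀ s, φ.subst s ∈ T)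
    {Δ : List Fml} (h : Consistent T Δ) : ∃ Γ, Henkin T Γ ∧ ∀ φ ∈ Δ, φ ∈ Γ := by
  have : Nonempty Fml := ⟨.bot⟩
  obtain ⟨enum, henum⟩ := exists_surjective_nat Fml
  choose! f hf₁ hf₂ hf₃ hf₄ using fun (Δ : List Fml) (h : Consistent T Δ) (φ : Fml) =>
    h.exists_step hT φ
  let D : ℕ → List Fml := fun n => Nat.rec Δ (fun n Δ => f Δ (enum n)) n
  have hD : ∀ n, Consistent T (D n) := fun n => by
    induction n with
    | zero => exact h
    | succ n ih => exact hf₁ _ ih _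
  have hmono : Monotone fun n => {φ | φ ∈ D n} :=
    monotone_nat_of_le_succ fun n φ hφ => hf₂ _ (hD n) _ hφ
  have hfin : ∀ Δ' : List Fml, (∀ ψ ∈ Δ', ∃ n, ψ ∈ D n) → ∃ n, Δ' ⊆ D n := by
    intro Δ'
    induction Δ' with
    | nil => exact fun _ => ⟨0, by simp⟩
    | cons ψ Δ' ih =>
      intro h'
      obtain ⟨n, hn⟩ := ih fun ψ hψ => h' ψ (by simp [hψ])
      obtain ⟨m, hm⟩ := h' ψ (by simp)
      refine ⟨max n m, List.cons_subset.2 ⟨hmono (le_max_right n m) hm, fun χ hχ => ?_⟩⟩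
      exact hmono (le_max_left n m) (hn hχ)
  have hcons : ∀ Δ' : List Fml, (∀ ψ ∈ Δ', ∃ n, ψ ∈ D n) → Consistent T Δ' := fun Δ' h' hp => by
    obtain ⟨n, hn⟩ := hfin Δ' h'
    exact hD n (hp.weaken hn)
  have hor : ∀ φ, (∃ n, φ ∈ D n) ∨ ∃ n, φ.neg ∈ D n := fun φ => by
    obtain ⟨n, rfl⟩ := henum φ
    exact (hf₃ (D n) (hD n) (enum n)).imp (fun h => ⟨n + 1, h⟩) fun h => ⟨n + 1, h⟩
  have hclosed : ∀ {Δ' φ}, (∀ ψ ∈ Δ', ∃ n, ψ ∈ D n) → Prf T Δ' φ → ∃ n, φ ∈ D n := by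
    intro Δ' φ h' hp
    refine (hor φ).resolve_right fun hn => hcons (φ.neg :: Δ') ?_ ?_
    · simpa using ⟨hn, h'⟩
    · exact .impE (φ := φ) (.hyp List.mem_cons_self) (hp.weaken (List.subset_cons_self _ _))
  refine ⟨{φ | ∃ n, φ ∈ D n}, ⟨hclosed, fun hb => ?_, hor, fun {σ φ} h' => ?_⟩,
    fun φ hφ => ⟨0, hφ⟩⟩
  · exact hcons [.bot] (by simpa using hb) (.hyp (by simp))
  · obtain ⟨n, hn⟩ := henum (.all σ φ)
    rcases hf₄ (D n) (hD n) (enum n) σ φ hn with h₁ | ⟨t, ht⟩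
    · exact ⟨n + 1, hn ▸ h₁⟩
    · refine (hcons [(φ.inst t).neg, φ.inst t] ?_ ?_).elim
      · simpa using ⟨⟨n + 1, ht⟩, h' t⟩
      · exact .impE (φ := φ.inst t) (.hyp List.mem_cons_self) (.hyp (by simp))

namespace Henkin

variable {T Γ : Set Fml} (h : Henkin T Γ)
include h

theorem theory {φ : Fml} (hφ : φ ∈ T) : φ ∈ Γ := h.closed (Δ := []) (by simp) (.theory hφ)

theorem mp {φ ψ : Fml} (h₁ : (φ ⟹ ψ) ∈ Γ) (h₂ : φ ∈ Γ) : ψ ∈ Γ :=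
  h.closed (Δ := [φ ⟹ ψ, φ]) (by simp [h₁, h₂])
    (.impE (.hyp (by simp)) (.hyp (by simp) : Prf T _ φ))

theorem imp_iff {φ ψ : Fml} : (φ ⟹ ψ) ∈ Γ ↔ (φ ∈ Γ → ψ ∈ Γ) := by
  refine ⟨h.mp, fun h' => ?_⟩
  rcases h.mem_or φ with h₁ | h₁
  · exact h.closed (Δ := [ψ]) (by simp [h' h₁]) (.impI (.hyp (by simp)))
  · refine h.closed (Δ := [φ.neg]) (by simp [h₁]) (.impI (.exfalso ?_ _))
    exact .impE (φ := φ) (.hyp (List.mem_cons_of_mem _ List.mem_cons_self)) (.hyp (by simp))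

theorem all_iff {σ : Ty} {φ : Fml} : Fml.all σ φ ∈ Γ ↔ ∀ t : Tm σ, φ.inst t ∈ Γ :=
  ⟨fun h' t => h.closed (Δ := [.all σ φ]) (by simp [h']) (.allE t (.hyp (by simp))), h.witness⟩

theorem eqAt_arr_iff {σ τ : Ty} {s t : Tm (σ ⇒ τ)} :
    eqAt (σ ⇒ τ) s t ∈ Γ ↔ ∀ z : Tm σ, eqAt τ (s ⬝ z) (t ⬝ z) ∈ Γ := by
  simp only [eqAt, h.all_iff, Fml.inst, eqAt_subst, Tm.subst, Tm.wk_subst_cons, Tm.subst_var,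
    Sub.cons_zero]

theorem eq_subst (φ : Fml) {s t : Tm o} (h₁ : Fml.eq s t ∈ Γ) (h₂ : φ.inst s ∈ Γ) :
    φ.inst t ∈ Γ :=
  h.closed (Δ := [.eq s t, φ.inst s]) (by simp [h₁, h₂])
    (.eqSubst (s := s) φ (.hyp (by simp)) (.hyp (by simp)))

theorem eqAt_refl {σ : Ty} (s : Tm σ) : eqAt σ s s ∈ Γ := by
  induction σ with
  | o => exact h.closed (Δ := []) (by simp) (.eqRefl s)
  | arr σ τ _ ih => exact h.eqAt_arr_iff.2 fun z => ih _

theorem eqAt_symm {σ : Ty} {s t : Tm σ} (h₁ : eqAt σ s t ∈ Γ) : eqAt σ t s ∈ Γ := by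
  induction σ with
  | o =>
    have := h.eq_subst (.eq (.var o 0) (s.wk o 1)) (s := s) (t := t) h₁
    simp only [Fml.inst, Fml.subst, Tm.subst, Tm.wk_subst_cons, Tm.subst_var,
      Sub.cons_zero] at this
    exact this (h.eqAt_refl s)
  | arr σ τ _ ih => exact h.eqAt_arr_iff.2 fun z => ih (h.eqAt_arr_iff.1 h₁ z)

theorem eqAt_trans {σ : Ty} {s t u : Tm σ} (h₁ : eqAt σ s t ∈ Γ) (h₂ : eqAt σ t u ∈ Γ) :
    eqAt σ s u ∈ Γ := by
  induction σ with
  | o =>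
    have := h.eq_subst (.eq (s.wk o 1) (.var o 0)) (s := t) (t := u) h₂
    simp only [Fml.inst, Fml.subst, Tm.subst, Tm.wk_subst_cons, Tm.subst_var,
      Sub.cons_zero] at this
    exact this h₁
  | arr σ τ _ ih =>
    exact h.eqAt_arr_iff.2 fun z => ih (h.eqAt_arr_iff.1 h₁ z) (h.eqAt_arr_iff.1 h₂ z)

theorem lt_congr {s s' t t' : Tm o} (h₁ : Fml.eq s s' ∈ Γ) (h₂ : Fml.eq t t' ∈ Γ)
    (hlt : Fml.lt s t ∈ Γ) : Fml.lt s' t' ∈ Γ := by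
  have h₃ := h.eq_subst (.lt (.var o 0) (t.wk o 1)) h₁
  have h₄ := h.eq_subst (.lt (s'.wk o 1) (.var o 0)) h₂
  simp only [Fml.inst, Fml.subst, Tm.subst, Tm.wk_subst_cons, Tm.subst_var,
      Sub.cons_zero] at h₃ h₄
  exact h₄ (h₃ hlt)

/-- The extensionality axioms enter here: they make application well defined on classes of provably
equal terms. -/
theorem app_congr (hT : RCA0 ⊆ T) {σ τ : Ty} {f g : Tm (σ ⇒ τ)} {s t : Tm σ}
    (h₁ : eqAt (σ ⇒ τ) f g ∈ Γ) (h₂ : eqAt σ s t ∈ Γ) : eqAt τ (f ⬝ s) (g ⬝ t) ∈ Γ :=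
  h.eqAt_trans (h.mp (h.theory (hT (.extensionality s t f))) h₂) (h.eqAt_arr_iff.1 h₁ t)

/-- Equality of terms according to `Γ`. -/
def setoid (σ : Ty) : Setoid (Tm σ) where
  r s t := eqAt σ s t ∈ Γ
  iseqv := ⟨h.eqAt_refl, h.eqAt_symm, h.eqAt_trans⟩

/-- The term model. -/
def model (hT : RCA0 ⊆ T) : Model where
  C σ := Quotient (h.setoid σ)
  app := Quotient.map₂ Tm.app fun _ _ h₁ _ _ h₂ => h.app_congr hT h₁ h₂
  ext f g := Quotient.inductionOn₂ f g fun _ _ h' =>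
    Quotient.sound (h.eqAt_arr_iff.2 fun z => Quotient.exact (h' (Quotient.mk _ z)))
  zero := Quotient.mk _ .zero
  one := Quotient.mk _ .one
  add := Quotient.mk _ .add
  mul := Quotient.mk _ .mul
  comK ρ τ := Quotient.mk _ (.comK ρ τ)
  comS δ ρ τ := Quotient.mk _ (.comS δ ρ τ)
  recO := Quotient.mk _ .recO
  lt := Quotient.lift₂ (fun s t => Fml.lt s t ∈ Γ) fun _ _ _ _ h₁ h₂ =>
    propext ⟨h.lt_congr h₁ h₂, h.lt_congr (h.eqAt_symm h₁) (h.eqAt_symm h₂)⟩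

/-- The object of the term model that is denoted by a term. -/
def den (hT : RCA0 ⊆ T) {σ : Ty} (t : Tm σ) : (h.model hT).C σ := Quotient.mk (h.setoid σ) t

theorem den_surjective (hT : RCA0 ⊆ T) {σ : Ty} (x : (h.model hT).C σ) : ∃ t, h.den hT t = x :=
  Quotient.exists_rep x

/-- The assignment of the term model that belongs to a substitution. -/
def env (hT : RCA0 ⊆ T) (s : Sub) : (h.model hT).Env := fun σ n => h.den hT (s σ n)

theorem tm_eval (hT : RCA0 ⊆ T) (s : Sub) {σ : Ty} (t : Tm σ) :
    t.eval (h.env hT s) = h.den hT (t.subst s) := by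
  induction t with
  | app f a ihf iha =>
    rw [Tm.eval, ihf, iha]
    rfl
  | _ => rfl

theorem env_cons (hT : RCA0 ⊆ T) (s : Sub) {σ : Ty} (t : Tm σ) :
    Env.cons (h.den hT t) (h.env hT s) = h.env hT (Sub.cons t s) := by
  funext τ n
  by_cases e : σ = τ
  · subst e
    cases n <;> simp [env]
  · simp [env, Env.cons_ne e, Sub.cons_ne e]

/-- The truth lemma. It is stated for all substitutions because the quantifier case extends the
assignment by the class of an arbitrary term; that case rests on the witness property. -/
theorem fml_eval (hT : RCA0 ⊆ T) (s : Sub) (φ : Fml) :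
    φ.eval (h.env hT s) ↔ φ.subst s ∈ Γ := by
  induction φ generalizing s with
  | eq a b =>
    rw [Fml.eval, h.tm_eval, h.tm_eval]
    exact Quotient.eq
  | lt a b =>
    rw [Fml.eval, h.tm_eval, h.tm_eval]
    rfl
  | bot => exact iff_of_false id h.bot
  | imp φ ψ ih₁ ih₂ => rw [Fml.eval, ih₁, ih₂, Fml.subst, h.imp_iff]
  | all σ φ ih =>
    rw [Fml.eval, Fml.subst, h.all_iff]
    refine Iff.trans ⟨fun h' t => h' (h.den hT t), fun h' x => ?_⟩
      (forall_congr' fun t => by rw [Fml.subst_lift_inst, ← ih, ← h.env_cons])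
    obtain ⟨t, rfl⟩ := h.den_surjective hT x
    exact h' t

/-- Every assignment in the term model comes from a substitution, so validity of an axiom with free
variables amounts to membership of its substitution instances. -/
theorem model_sat (hT : RCA0 ⊆ T) (hs : ∀ φ ∈ T, ∀ s, φ.subst s ∈ T) : (h.model hT).Sat T := by
  intro φ hφ e
  choose s hse using fun σ n => h.den_surjective hT (e σ n)
  have e' : e = h.env hT s := by
    funext σ n
    exact (hse σ n).symm
  rw [e', h.fml_eval]
  exact h.theory (hs φ hφ s)

end Henkin

/-- Completeness for extensions of `RCA₀^ω` by axioms closed under substitution. -/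
theorem proves_of_valid {T : Set Fml} (hT : RCA0 ⊆ T) (hs : ∀ φ ∈ T, ∀ s, φ.subst s ∈ T) {φ : Fml}
    (hφ : ∀ M : Model, M.Sat T → ∀ e : M.Env, φ.eval e) : T ⊩ φ := by
  by_contra hp
  have hc : Consistent T [φ.neg] := fun h => hp (.raa h)
  obtain ⟨Γ, h, hΓ⟩ := hc.exists_henkin hs
  have h₁ := (h.fml_eval hT Tm.var φ).1 (hφ _ (h.model_sat hT hs) _)
  rw [Fml.subst_var] at h₁
  exact h.bot (h.mp (hΓ φ.neg (by simp)) h₁)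

end HORM

/-! ### Arithmetic inside a model of `ACA₀^ω`. -/

namespace HORM

open Ty Model

/-- Models of `ACA₀^ω`. -/
class Model.IsACA (M : Model) : Prop where
  sat : M.Sat ACA0

namespace Model

variable {M : Model}

instance {σ τ : Ty} : CoeFun (M.C (σ ⇒ τ)) fun _ => M.C σ → M.C τ := ⟨M.app⟩

instance : Zero (M.C o) := ⟨M.zero⟩
instance : One (M.C o) := ⟨M.one⟩
instance : Add (M.C o) := ⟨fun x y => M.add x y⟩
instance : Mul (M.C o) := ⟨fun x y => M.mul x y⟩
instance : LT (M.C o) := ⟨M.lt⟩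

instance instInhabited : (σ : Ty) → Inhabited (M.C σ)
  | .o => ⟨0⟩
  | .arr σ τ => ⟨M.comK τ σ (instInhabited τ).default⟩

/-- The assignment with given values at the variables of type `1`. -/
def Env.ofSeq (e : ℕ → M.C t1) : M.Env := fun σ n => if h : t1 = σ then h ▸ e n else default

@[simp] theorem Env.ofSeq_t1 (e : ℕ → M.C t1) (n : ℕ) : Env.ofSeq e t1 n = e n := by
  simp [Env.ofSeq]

theorem eval_zero (e : M.Env) : Tm.zero.eval e = 0 := rfl
theorem eval_one (e : M.Env) : Tm.one.eval e = 1 := rfl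
theorem eval_plus (e : M.Env) (s t : Tm o) : (plus s t).eval e = s.eval e + t.eval e := rfl
theorem eval_times (e : M.Env) (s t : Tm o) : (times s t).eval e = s.eval e * t.eval e := rfl
theorem eval_suc (e : M.Env) (s : Tm o) : (suc s).eval e = s.eval e + 1 := rfl

variable [hM : M.IsACA]


/-- An assignment with given values of the variables `0`, `1` and `2` of given types. -/
def env₃ {ρ σ τ : Ty} (x : M.C ρ) (y : M.C σ) (z : M.C τ) : M.Env := fun δ n =>
  match n with
  | 0 => if h : ρ = δ then h ▸ x else default
  | 1 => if h : σ = δ then h ▸ y else default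
  | _ => if h : τ = δ then h ▸ z else default

section env₃

omit hM
variable {ρ σ τ : Ty} (x : M.C ρ) (y : M.C σ) (z : M.C τ)

@[simp] theorem env₃_zero : env₃ x y z ρ 0 = x := by simp [env₃]
@[simp] theorem env₃_one : env₃ x y z σ 1 = y := by simp [env₃]
@[simp] theorem env₃_two : env₃ x y z τ 2 = z := by simp [env₃]

end env₃

theorem IsACA.rca {φ : Fml} (h : RCA0 φ) (e : M.Env) : φ.eval e := hM.sat φ (.inr h) e

/-! The axioms, read in the model. -/

theorem suc_ne_zero (x : M.C o) : x + 1 ≠ 0 :=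
  IsACA.rca (.suc_ne_zero (.var o 0)) (env₃ x x x)

theorem suc_inj {x y : M.C o} : x + 1 = y + 1 → x = y :=
  IsACA.rca (.suc_inj (.var o 0) (.var o 1)) (env₃ x y y)

protected theorem add_zero (x : M.C o) : x + 0 = x :=
  IsACA.rca (.add_zero (.var o 0)) (env₃ x x x)

theorem add_suc (x y : M.C o) : x + (y + 1) = x + y + 1 :=
  IsACA.rca (.add_suc (.var o 0) (.var o 1)) (env₃ x y y)

protected theorem mul_zero (x : M.C o) : x * 0 = 0 :=
  IsACA.rca (.mul_zero (.var o 0)) (env₃ x x x)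

theorem mul_suc (x y : M.C o) : x * (y + 1) = x * y + x :=
  IsACA.rca (.mul_suc (.var o 0) (.var o 1)) (env₃ x y y)

protected theorem not_lt_zero (x : M.C o) : ¬ x < 0 :=
  IsACA.rca (.not_lt_zero (.var o 0)) (env₃ x x x)

theorem lt_suc {x y : M.C o} : x < y + 1 ↔ x < y ∨ x = y := by
  have := IsACA.rca (.lt_suc (.var o 0) (.var o 1)) (env₃ x y y)
  rwa [Fml.eval_iff, Fml.eval_le] at this

@[simp] theorem comK_apply {ρ τ : Ty} (x : M.C ρ) (y : M.C τ) : M.comK ρ τ x y = x := by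
  simpa [Tm.eval] using IsACA.rca (.comK (.var ρ 0) (.var τ 1)) (env₃ x y y)

@[simp] theorem comS_apply {δ ρ τ : Ty} (x : M.C (δ ⇒ ρ ⇒ τ)) (y : M.C (δ ⇒ ρ)) (z : M.C δ) :
    M.comS δ ρ τ x y z = x z (y z) := by
  simpa [Tm.eval] using 
    IsACA.rca (.comS (.var (δ ⇒ ρ ⇒ τ) 0) (.var (δ ⇒ ρ) 1) (.var δ 2)) (env₃ x y z)

@[simp] theorem recO_zero (f : M.C (o ⇒ o ⇒ o)) (m : M.C o) : M.recO f m 0 = m := by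
  have := IsACA.rca (.rec_zero (.var _ 0) (.var _ 1)) (env₃ f m m)
  simp only [Fml.eval_eq, Tm.eval, env₃_zero, env₃_one] at this
  exact this

@[simp] theorem recO_suc (f : M.C (o ⇒ o ⇒ o)) (m n : M.C o) :
    M.recO f m (n + 1) = f n (M.recO f m n) := by
  simpa [Tm.eval, eval_suc] using IsACA.rca (.rec_suc (.var _ 0) (.var _ 1) (.var _ 2)) (env₃ f m n)

/-- `M.C o` may be nonstandard, so this replaces induction on natural numbers; an existential claim
has to be given an explicit witness before it can be proved this way. -/
theorem eval_induction {φ : Fml} (hφ : φ.QF) (e : M.Env) (h₀ : φ.eval (Env.cons (0 : M.C o) e))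
    (h₁ : ∀ n : M.C o, φ.eval (Env.cons n e) → φ.eval (Env.cons (n + 1) e)) (n : M.C o) :
    φ.eval (Env.cons n e) := by
  refine IsACA.rca (.induction φ hφ) e ((Fml.eval_inst _ _ _).2 h₀) (fun n hn => ?_) n
  rw [Fml.eval_subst, Env.eval_cons, Env.eval_up, eval_suc]
  simpa [Tm.eval] using h₁ n hn

/-! Functions and predicates that are given by objects of the model. -/

/-- The function `f` is represented by an object of the model. -/
@[fun_prop]
def Rep {τ : Ty} (f : M.C o → M.C τ) : Prop := ∃ F : M.C (o ⇒ τ), ∀ n, F n = f n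

namespace Rep

@[fun_prop]
theorem id : Rep fun n : M.C o => n := ⟨M.comS o t1 o (M.comK o t1) (M.comK o o), by simp⟩

@[fun_prop]
theorem const {τ : Ty} (x : M.C τ) : Rep fun _ : M.C o => x := ⟨M.comK τ o x, by simp⟩

theorem app {σ τ : Ty} {f : M.C o → M.C (σ ⇒ τ)} {g : M.C o → M.C σ} (hf : Rep f) (hg : Rep g) :
    Rep fun n => f n (g n) := by
  obtain ⟨F, hF⟩ := hf
  obtain ⟨G, hG⟩ := hg
  exact ⟨M.comS _ _ _ F G, fun n => by simp [hF, hG]⟩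

@[fun_prop]
theorem comp {τ : Ty} {f : M.C o → M.C τ} {g : M.C o → M.C o} (hf : Rep f) (hg : Rep g) :
    Rep fun n => f (g n) := by
  obtain ⟨F, hF⟩ := hf
  simpa only [hF] using app (const F) hg

@[fun_prop]
theorem app_object {τ : Ty} (F : M.C (o ⇒ τ)) {g : M.C o → M.C o} (hg : Rep g) :
    Rep fun n => F (g n) :=
  app (const F) hg

@[fun_prop]
theorem app₂_object {τ : Ty} (F : M.C (o ⇒ o ⇒ τ)) {f g : M.C o → M.C o} (hf : Rep f)
    (hg : Rep g) : Rep fun n => F (f n) (g n) :=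
  app (app (const F) hf) hg

@[fun_prop]
theorem add {f g : M.C o → M.C o} (hf : Rep f) (hg : Rep g) : Rep fun n => f n + g n :=
  app (app (const M.add) hf) hg

@[fun_prop]
theorem mul {f g : M.C o → M.C o} (hf : Rep f) (hg : Rep g) : Rep fun n => f n * g n :=
  app (app (const M.mul) hf) hg

end Rep

/-- The predicate `P` is given by a quantifier-free formula with parameters of type `1`. -/
def QFPred (P : M.C o → Prop) : Prop :=
  ∃ φ : Fml, φ.QF ∧ ∃ e : ℕ → M.C t1, ∀ n, P n ↔ φ.eval (Env.cons n (Env.ofSeq e))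

namespace QFPred

omit hM in
theorem eq {f g : M.C o → M.C o} (hf : Rep f) (hg : Rep g) : QFPred fun n => f n = g n := by
  obtain ⟨F, hF⟩ := hf
  obtain ⟨G, hG⟩ := hg
  refine ⟨.eq (.var t1 0 ⬝ .var o 0) (.var t1 1 ⬝ .var o 0), trivial,
    fun n => if n = 0 then F else G, fun n => ?_⟩
  simp [Tm.eval, Env.cons_ne, hF, hG]

omit hM in
theorem lt {f g : M.C o → M.C o} (hf : Rep f) (hg : Rep g) : QFPred fun n => f n < g n := by
  obtain ⟨F, hF⟩ := hf
  obtain ⟨G, hG⟩ := hg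
  refine ⟨.lt (.var t1 0 ⬝ .var o 0) (.var t1 1 ⬝ .var o 0), trivial,
    fun n => if n = 0 then F else G, fun n => ?_⟩
  simp only [Fml.eval, Tm.eval]
  simp [Env.cons_ne, hF, hG]
  rfl

omit hM in
theorem imp {P Q : M.C o → Prop} (hP : QFPred P) (hQ : QFPred Q) : QFPred fun n => P n → Q n := by
  obtain ⟨φ, hφ, e, he⟩ := hP
  obtain ⟨ψ, hψ, d, hd⟩ := hQ
  -- The two parameter lists are interleaved: those of `φ` go to even indices, those of `ψ` to odd
  -- ones.
  let s (i : ℕ) : Sub := fun σ n => if σ = t1 then .var σ (2 * n + i) else .var σ n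
  refine ⟨φ.subst (s 0) ⟹ ψ.subst (s 1), ⟨hφ.subst _, hψ.subst _⟩,
    fun n => if n % 2 = 0 then e (n / 2) else d (n / 2), fun n => ?_⟩
  change (P n → Q n) ↔ _
  rw [he, hd, Fml.eval_imp, Fml.eval_subst, Fml.eval_subst]
  congr! 2 <;>
  · funext σ k
    by_cases h : σ = t1
    · subst h
      simp [s, Tm.eval, Env.cons_ne, Nat.add_mod, Nat.mul_add_div]
    · cases k <;> simp [s, h, Tm.eval, Env.cons, Env.ofSeq, Ne.symm h]

omit hM in
theorem const (p : Prop) : QFPred fun _ : M.C o => p := by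
  by_cases h : p
  · exact ⟨.imp .bot .bot, ⟨trivial, trivial⟩, fun _ => default, fun n => by simp [h]⟩
  · exact ⟨.bot, trivial, fun _ => default, fun n => by simp [h]⟩

omit hM in
theorem not {P : M.C o → Prop} (hP : QFPred P) : QFPred fun n => ¬ P n := hP.imp (const False)

omit hM in
theorem or {P Q : M.C o → Prop} (hP : QFPred P) (hQ : QFPred Q) : QFPred fun n => P n ∨ Q n := by
  simpa only [← or_iff_not_imp_left] using hP.not.imp hQ

omit hM in
theorem and {P Q : M.C o → Prop} (hP : QFPred P) (hQ : QFPred Q) : QFPred fun n => P n ∧ Q n := by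
  simpa only [Classical.not_imp, not_not] using (hP.imp hQ.not).not

theorem induction {P : M.C o → Prop} (hP : QFPred P) (h₀ : P 0) (h₁ : ∀ n, P n → P (n + 1))
    (n : M.C o) : P n := by
  obtain ⟨φ, hφ, e, he⟩ := hP
  simp only [he] at *
  exact eval_induction hφ _ h₀ h₁ n

end QFPred

/-! The objects of type `o` form an ordered semiring. -/

protected theorem zero_add (n : M.C o) : 0 + n = n :=
  (QFPred.eq (f := fun n => 0 + n) (g := fun n => n) (by fun_prop) (by fun_prop)).induction
    (Model.add_zero 0) (fun n h => by rw [add_suc, h]) n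

theorem suc_add (m n : M.C o) : m + 1 + n = m + n + 1 := by
  refine (QFPred.eq (f := fun n => m + 1 + n) (g := fun n => m + n + 1)
    (by fun_prop) (by fun_prop)).induction ?_ (fun n h => ?_) n
  · rw [Model.add_zero, Model.add_zero]
  · rw [add_suc, h, add_suc]

protected theorem add_comm (m n : M.C o) : m + n = n + m := by
  refine (QFPred.eq (f := fun n => m + n) (g := fun n => n + m)
    (by fun_prop) (by fun_prop)).induction ?_ (fun n h => ?_) n
  · rw [Model.add_zero, Model.zero_add]
  · rw [add_suc, h, suc_add]

protected theorem add_assoc (a b n : M.C o) : a + b + n = a + (b + n) := by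
  refine (QFPred.eq (f := fun n => a + b + n) (g := fun n => a + (b + n))
    (by fun_prop) (by fun_prop)).induction ?_ (fun n h => ?_) n
  · rw [Model.add_zero, Model.add_zero]
  · rw [add_suc, h, add_suc, add_suc]

instance : AddCommMonoid (M.C o) where
  add_assoc := Model.add_assoc
  zero_add := Model.zero_add
  add_zero := Model.add_zero
  add_comm := Model.add_comm
  nsmul := nsmulRec

protected theorem zero_mul (n : M.C o) : 0 * n = 0 := by
  refine (QFPred.eq (f := fun n => 0 * n) (g := fun _ => 0)
    (by fun_prop) (by fun_prop)).induction ?_ (fun n h => ?_) n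
  · rw [Model.mul_zero]
  · rw [mul_suc, h, add_zero]

theorem suc_mul (m n : M.C o) : (m + 1) * n = m * n + n := by
  refine (QFPred.eq (f := fun n => (m + 1) * n) (g := fun n => m * n + n)
    (by fun_prop) (by fun_prop)).induction ?_ (fun n h => ?_) n
  · rw [Model.mul_zero, Model.mul_zero, add_zero]
  · rw [mul_suc, h, mul_suc]
    abel

protected theorem mul_comm (m n : M.C o) : m * n = n * m := by
  refine (QFPred.eq (f := fun n => m * n) (g := fun n => n * m)
    (by fun_prop) (by fun_prop)).induction ?_ (fun n h => ?_) n
  · rw [Model.mul_zero, Model.zero_mul]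
  · rw [mul_suc, h, suc_mul]

protected theorem mul_add (a b n : M.C o) : n * (a + b) = n * a + n * b := by
  refine (QFPred.eq (f := fun n => n * (a + b)) (g := fun n => n * a + n * b)
    (by fun_prop) (by fun_prop)).induction ?_ (fun n h => ?_) n
  · rw [Model.zero_mul, Model.zero_mul, Model.zero_mul, add_zero]
  · rw [suc_mul, suc_mul, suc_mul, h]
    abel

protected theorem mul_assoc (a b n : M.C o) : a * b * n = a * (b * n) := by
  refine (QFPred.eq (f := fun n => a * b * n) (g := fun n => a * (b * n))
    (by fun_prop) (by fun_prop)).induction ?_ (fun n h => ?_) n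
  · rw [Model.mul_zero, Model.mul_zero, Model.mul_zero]
  · rw [mul_suc, h, mul_suc, Model.mul_add]

protected theorem mul_one (n : M.C o) : n * 1 = n := by
  have := mul_suc n 0
  rwa [Model.mul_zero, zero_add, zero_add] at this

instance : CommSemiring (M.C o) where
  left_distrib a b c := Model.mul_add b c a
  right_distrib a b c := by simp only [Model.mul_comm _ c, Model.mul_add]
  zero_mul := Model.zero_mul
  mul_zero := Model.mul_zero
  mul_assoc := Model.mul_assoc
  one_mul n := by rw [Model.mul_comm, Model.mul_one]
  mul_one := Model.mul_one
  mul_comm := Model.mul_comm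

theorem suc_pos (n : M.C o) : 0 < n + 1 := by
  refine (QFPred.lt (f := fun _ => 0) (g := fun n => n + 1)
    (by fun_prop) (by fun_prop)).induction ?_ (fun n h => ?_) n
  · exact lt_suc.2 (.inr rfl)
  · exact lt_suc.2 (.inl h)

theorem suc_lt_or {b a : M.C o} : b < a → b + 1 < a ∨ b + 1 = a := by
  refine ((QFPred.lt (f := fun _ => b) (g := fun a => a) (by fun_prop) (by fun_prop)).imp
    ((QFPred.lt (f := fun _ => b + 1) (g := fun a => a) (by fun_prop) (by fun_prop)).or
    (QFPred.eq (f := fun _ => b + 1) (g := fun a => a) (by fun_prop) (by fun_prop)))).induction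
    (fun h => (Model.not_lt_zero _ h).elim) (fun n h h' => ?_) a
  rcases lt_suc.1 h' with h' | rfl
  · exact .inl (lt_suc.2 (h h'))
  · exact .inr rfl

protected theorem lt_trans {a b c : M.C o} (hab : a < b) : b < c → a < c := by
  refine ((QFPred.lt (f := fun _ => b) (g := fun c => c) (by fun_prop) (by fun_prop)).imp
    (QFPred.lt (f := fun _ => a) (g := fun c => c) (by fun_prop) (by fun_prop))).induction
    (fun h => (Model.not_lt_zero _ h).elim) (fun n h h' => ?_) c
  rcases lt_suc.1 h' with h' | rfl
  · exact lt_suc.2 (.inl (h h'))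
  · exact lt_suc.2 (.inl hab)

protected theorem lt_irrefl (n : M.C o) : ¬ n < n := by
  refine (QFPred.lt (f := fun n => n) (g := fun n => n)
    (by fun_prop) (by fun_prop)).not.induction (Model.not_lt_zero 0) (fun n h h' => h ?_) n
  have h₁ : n < n + 1 := lt_suc.2 (.inr rfl)
  rcases lt_suc.1 h' with h' | h'
  · exact Model.lt_trans h₁ h'
  · rwa [h'] at h₁

protected theorem lt_trichotomy (a b : M.C o) : a < b ∨ a = b ∨ b < a := by
  refine ((QFPred.lt (f := fun _ => a) (g := fun b => b) (by fun_prop) (by fun_prop)).or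
    ((QFPred.eq (f := fun _ => a) (g := fun b => b) (by fun_prop) (by fun_prop)).or
    (QFPred.lt (f := fun b => b) (g := fun _ => a) (by fun_prop) (by fun_prop)))).induction
    ?_ (fun n h => ?_) b
  · have : ∀ a : M.C o, 0 < a ∨ 0 = a := (QFPred.or
      (QFPred.lt (f := fun _ => 0) (g := fun b => b) (by fun_prop) (by fun_prop))
      (QFPred.eq (f := fun _ => 0) (g := fun b => b) (by fun_prop) (by fun_prop))).induction
      (.inr rfl) fun n _ => .inl (suc_pos n)
    rcases this a with h | h
    · exact .inr (.inr h)
    · exact .inr (.inl h.symm)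
  · rcases h with h | rfl | h
    · exact .inl (lt_suc.2 (.inl h))
    · exact .inl (lt_suc.2 (.inr rfl))
    · rcases suc_lt_or h with h | h
      · exact .inr (.inr h)
      · exact .inr (.inl h.symm)

noncomputable instance : LinearOrder (M.C o) where
  le a b := a < b ∨ a = b
  le_refl a := .inr rfl
  le_trans a b c := by
    rintro (h | rfl) (h' | rfl)
    · exact .inl (Model.lt_trans h h')
    · exact .inl h
    · exact .inl h'
    · exact .inr rfl
  le_antisymm a b := by
    rintro (h | rfl) h'
    · rcases h' with h' | rfl
      · exact (Model.lt_irrefl _ (Model.lt_trans h h')).elim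
      · rfl
    · rfl
  le_total a b := by
    rcases Model.lt_trichotomy a b with h | rfl | h
    · exact .inl (.inl h)
    · exact .inl (.inr rfl)
    · exact .inr (.inl h)
  lt_iff_le_not_ge a b := by
    refine ⟨fun h => ⟨.inl h, ?_⟩, ?_⟩
    · rintro (h' | rfl)
      · exact Model.lt_irrefl _ (Model.lt_trans h h')
      · exact Model.lt_irrefl _ h
    · rintro ⟨h | rfl, h'⟩
      · exact h
      · exact (h' (.inr rfl)).elim
  toDecidableLE := Classical.decRel _

theorem lt_suc_iff {a b : M.C o} : a < b + 1 ↔ a ≤ b := lt_suc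

theorem suc_le_iff {a b : M.C o} : a + 1 ≤ b ↔ a < b :=
  ⟨fun h => (lt_suc_iff.2 le_rfl).trans_le h, suc_lt_or⟩

theorem add_lt_add_object {a b : M.C o} (h : a < b) (n : M.C o) : a + n < b + n := by
  refine (QFPred.lt (f := fun n => a + n) (g := fun n => b + n)
    (by fun_prop) (by fun_prop)).induction ?_ (fun n h => ?_) n
  · rwa [add_zero, add_zero]
  · rw [← add_assoc, ← add_assoc]
    exact lt_suc_iff.2 (suc_le_iff.2 h)

protected theorem zero_le (n : M.C o) : 0 ≤ n := lt_suc_iff.1 (suc_pos n)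

instance : IsOrderedCancelAddMonoid (M.C o) where
  add_le_add_left a b h c := by
    rcases h.lt_or_eq with h | rfl
    · exact (add_lt_add_object h c).le
    · rfl
  le_of_add_le_add_left a b c h := by
    by_contra! h'
    rw [add_comm a, add_comm a] at h
    exact (add_lt_add_object h' a).not_ge h

theorem mul_suc_lt {a b : M.C o} (h : a < b) (n : M.C o) : a * (n + 1) < b * (n + 1) := by
  refine (QFPred.lt (f := fun n => a * (n + 1)) (g := fun n => b * (n + 1))
    (by fun_prop) (by fun_prop)).induction ?_ (fun n h' => ?_) n
  · rwa [zero_add, mul_one, mul_one]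
  · rw [mul_suc, mul_suc b]
    exact add_lt_add h' h

/-- The predecessor. -/
def pred : M.C t1 := M.recO (M.comK o o) 0

@[simp] theorem pred_zero : pred (0 : M.C o) = 0 := recO_zero _ _

@[simp] theorem pred_suc (n : M.C o) : pred (n + 1) = n := by simp [pred]

/-- Truncated subtraction. -/
def sub : M.C (o ⇒ o ⇒ o) := M.recO (M.comK t1 o pred)

@[simp] theorem sub_zero (a : M.C o) : sub a (0 : M.C o) = a := recO_zero _ _

@[simp] theorem sub_suc (a b : M.C o) : sub a (b + 1) = pred (sub a b) := by simp [sub]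

/-- The predecessor is an explicit witness, which leaves a quantifier-free statement for the
induction. -/
theorem exists_eq_suc {n : M.C o} (h : n ≠ 0) : ∃ m, n = m + 1 := by
  refine ⟨pred n, ?_⟩
  revert h
  exact ((QFPred.eq (f := fun n => n) (g := fun _ => 0) (by fun_prop) (by fun_prop)).not.imp
    (QFPred.eq (f := fun n => n) (g := fun n => pred n + 1)
    (by fun_prop) (by fun_prop))).induction (fun h => (h rfl).elim) (fun n _ _ => by simp) n

theorem exists_eq_suc_of_pos {n : M.C o} (h : 0 < n) : ∃ m, n = m + 1 := exists_eq_suc h.ne'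

instance : IsStrictOrderedRing (M.C o) where
  zero_le_one := Model.zero_le _
  exists_pair_ne := ⟨0, 1, fun h => suc_ne_zero (0 : M.C o) (by rw [zero_add, h])⟩
  mul_lt_mul_of_pos_left c hc a b h := by
    obtain ⟨n, rfl⟩ := exists_eq_suc_of_pos hc
    simpa only [mul_comm] using mul_suc_lt h n
  mul_lt_mul_of_pos_right c hc a b h := by
    obtain ⟨n, rfl⟩ := exists_eq_suc_of_pos hc
    exact mul_suc_lt h n

/-- The halves share one induction because the first, at the point where `b` reaches `a`, uses the
second at the previous number. -/
theorem sub_spec (a b : M.C o) : (a ≤ b → sub a b = 0) ∧ (b ≤ a → sub a b + b = a) := by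
  have hs : ∀ f g : M.C o → M.C o, Rep f → Rep g → QFPred fun n => f n ≤ g n := fun f g hf hg =>
    (QFPred.lt hf hg).or (QFPred.eq hf hg)
  refine (((hs (fun _ => a) (fun b => b) (by fun_prop) (by fun_prop)).imp
    (QFPred.eq (f := fun b => sub a b) (g := fun _ => 0) (by fun_prop) (by fun_prop))).and
    ((hs (fun b => b) (fun _ => a) (by fun_prop) (by fun_prop)).imp
    (QFPred.eq (f := fun b => sub a b + b) (g := fun _ => a)
    (by fun_prop) (by fun_prop)))).induction ?_ (fun n h => ?_) b
  · exact ⟨fun h => by simpa using le_antisymm h (Model.zero_le a), fun _ => by simp⟩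
  · rw [sub_suc]
    refine ⟨fun h' => ?_, fun h' => ?_⟩
    · rcases h'.lt_or_eq with h' | rfl
      · rw [h.1 (lt_suc_iff.1 h'), pred_zero]
      · have := h.2 (lt_suc_iff.2 le_rfl).le
        rw [show sub (n + 1) n = (0 + 1 : M.C o) from add_right_cancel (this.trans (by ring)), pred_suc]
    · have h₁ := h.2 ((lt_suc_iff.2 le_rfl).le.trans h')
      rcases eq_or_ne (sub a n) 0 with h₂ | h₂
      · rw [h₂, zero_add] at h₁
        exact ((suc_le_iff.1 h').ne h₁).elim
      · obtain ⟨m, hm⟩ := exists_eq_suc h₂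
        rw [hm] at h₁ ⊢
        rw [pred_suc, ← h₁]
        ring

theorem sub_eq_zero_iff {a b : M.C o} : sub a b = 0 ↔ a ≤ b := by
  refine ⟨fun h => ?_, (sub_spec a b).1⟩
  by_contra! h'
  have := (sub_spec a b).2 h'.le
  rw [h, zero_add] at this
  exact h'.ne this

instance : CanonicallyOrderedAdd (M.C o) where
  exists_add_of_le {a b} h := ⟨sub b a, by rw [add_comm, (sub_spec b a).2 h]⟩
  le_add_self a b := by simpa using Model.zero_le b
  le_self_add a b := by simpa using Model.zero_le b

theorem QFPred.le {f g : M.C o → M.C o} (hf : Rep f) (hg : Rep g) : QFPred fun n => f n ≤ g n :=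
  (QFPred.lt hf hg).or (QFPred.eq hf hg)

end Model

end HORM

/-! ### Definable functionals, powers of two and rational codes in a model. -/

namespace HORM

open Ty Model

/-! Abstraction. -/

/-- The term `λ x^σ. x`. -/
def idTm (σ : Ty) : Tm (σ ⇒ σ) := Tm.comS σ (o ⇒ σ) σ ⬝ Tm.comK σ (o ⇒ σ) ⬝ Tm.comK σ o

/-- The term `λ x^σ. t`, where `x` is the variable `0` of type `σ`. -/
def Tm.abs (σ : Ty) : {τ : Ty} → Tm τ → Tm (σ ⇒ τ)
  | τ, .var _ n =>
    if h : σ = τ then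
      match n with
      | 0 => h ▸ idTm σ
      | n + 1 => .comK τ σ ⬝ .var τ n
    else .comK τ σ ⬝ .var τ n
  | _, .app f a => .comS _ _ _ ⬝ f.abs σ ⬝ a.abs σ
  | _, .zero => .comK _ σ ⬝ .zero
  | _, .one => .comK _ σ ⬝ .one
  | _, .add => .comK _ σ ⬝ .add
  | _, .mul => .comK _ σ ⬝ .mul
  | _, .comK ρ τ => .comK _ σ ⬝ .comK ρ τ
  | _, .comS δ ρ τ => .comK _ σ ⬝ .comS δ ρ τ
  | _, .recO => .comK _ σ ⬝ .recO

variable {M : Model} [M.IsACA]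

@[simp] theorem Tm.eval_abs {σ τ : Ty} (t : Tm τ) (e : M.Env) (x : M.C σ) :
    (t.abs σ).eval e x = t.eval (Env.cons x e) := by
  induction t with
  | var τ n =>
    by_cases h : σ = τ
    · subst h
      cases n <;> simp [Tm.abs, Tm.eval, idTm]
    · simp [Tm.abs, Tm.eval, h, Env.cons_ne h]
  | app f a ihf iha => simp [Tm.abs, Tm.eval, ihf, iha]
  | _ => simp [Tm.abs, Tm.eval]

/-! Characteristic terms of arithmetical formulas. -/

/-- Formulas with quantifiers over the type `o` only. -/
def Fml.Arith : Fml → Prop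
  | eq _ _ => True
  | lt _ _ => True
  | bot => True
  | imp φ ψ => Arith φ ∧ Arith ψ
  | all σ φ => σ = o ∧ Arith φ

/-- The predecessor, as a closed term. -/
def predTm : Tm t1 := Tm.recO ⬝ Tm.comK o o ⬝ .zero

/-- Truncated subtraction, as a closed term. -/
def subTm : Tm (o ⇒ o ⇒ o) := Tm.recO ⬝ (Tm.comK t1 o ⬝ predTm)

/-- A term that vanishes if and only if `φ` holds, provided that `φ` is arithmetical and that the
variable `0` of type `2` denotes a functional as in `(∃²)`. -/
def Fml.char : Fml → Tm o
  | eq s t => plus (subTm ⬝ s ⬝ t) (subTm ⬝ t ⬝ s)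
  | lt s t => subTm ⬝ suc s ⬝ t
  | bot => .one
  | imp φ ψ => times (subTm ⬝ .one ⬝ φ.char) ψ.char
  | all _ φ => subTm ⬝ .one ⬝ (.var t2 0 ⬝ (subTm ⬝ .one ⬝ φ.char).abs o)

namespace Model

/-- The functional `Φ` decides whether a function has a zero. -/
def IsExistsTwo (Φ : M.C t2) : Prop :=
  (∀ f : M.C t1, Φ f ≤ 1) ∧ ∀ f : M.C t1, (∃ n : M.C o, f n = 0) ↔ Φ f = 0

variable (M) in
theorem exists_existsTwo : ∃ Φ : M.C t2, IsExistsTwo Φ := by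
  have h := IsACA.sat existsTwo (Set.mem_insert _ _) (default : M.Env)
  simp only [existsTwo, Fml.eval_ex, Fml.eval_and, Fml.eval_all, Fml.eval_le, Fml.eval_iff,
    Fml.eval_eq] at h
  simp only [Tm.eval, Env.cons_zero, Env.cons_ne (show t1 ≠ t2 by decide),
    Env.cons_ne (show o ≠ t1 by decide)] at h
  exact h

omit [M.IsACA] in
theorem eval_subTm (e : M.Env) (s t : Tm o) :
    (subTm ⬝ s ⬝ t).eval e = sub (s.eval e) (t.eval e) := rfl

theorem one_sub_eq_zero_iff {x : M.C o} : sub (1 : M.C o) x = 0 ↔ x ≠ 0 := by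
  rw [sub_eq_zero_iff, ← pos_iff_ne_zero, ← suc_le_iff, zero_add]

/-- Zero plays the role of truth: a sum vanishes when both summands do, a product when one factor
does, and truncated `1 - x` exchanges zero and nonzero. For a quantifier, the functional searches
for a zero of `1 - φ.char`, that is, a counterexample. Variables are counted per type, so binding a
number does not move the functional variable. -/
theorem eval_char {φ : Fml} (hφ : φ.Arith) {e : M.Env} (he : IsExistsTwo (e t2 0)) :
    φ.char.eval e = 0 ↔ φ.eval e := by
  induction φ generalizing e with
  | eq s t =>
    rw [Fml.char, eval_plus, eval_subTm, eval_subTm, add_eq_zero, sub_eq_zero_iff,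
      sub_eq_zero_iff, Fml.eval_eq]
    exact antisymm_iff
  | lt s t =>
    rw [Fml.char, eval_subTm, eval_suc, sub_eq_zero_iff, suc_le_iff]
    rfl
  | bot => exact iff_of_false one_ne_zero id
  | imp φ ψ ih₁ ih₂ =>
    rw [Fml.char, eval_times, eval_subTm, eval_one, mul_eq_zero, one_sub_eq_zero_iff, Ne,
      ih₁ hφ.1 he, ih₂ hφ.2 he, Fml.eval_imp, imp_iff_not_or]
  | all σ φ ih =>
    obtain ⟨rfl, hφ⟩ := hφ
    rw [Fml.char, eval_subTm, eval_one, one_sub_eq_zero_iff]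
    simp only [Tm.eval]
    rw [Ne, ← he.2, not_exists, Fml.eval_all]
    refine forall_congr' fun n => ?_
    have h02 : o ≠ t2 := by decide
    rw [Tm.eval_abs, eval_subTm, eval_one, one_sub_eq_zero_iff, not_not,
      ih hφ (by rwa [Env.cons_ne h02])]

/-! Powers of two and codes of rational numbers. -/

variable (M) in
/-- The function `n ↦ 2 ^ n`. -/
def pow : M.C t1 := pow2.eval default

omit [M.IsACA] in
theorem eval_pow2 (e : M.Env) (t : Tm o) : (pow2 ⬝ t).eval e = M.pow (t.eval e) := rfl

@[simp] theorem pow_zero : M.pow 0 = 1 := recO_zero _ _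

@[simp] theorem pow_suc (n : M.C o) : M.pow (n + 1) = M.pow n + M.pow n := by
  refine (recO_suc _ _ _).trans ?_
  simp [Tm.eval, idT]
  rfl

theorem lt_pow (n : M.C o) : n < M.pow n := by
  refine (QFPred.lt (f := fun n => n) (g := fun n => M.pow n)
    (by fun_prop) (by fun_prop)).induction (by simp) (fun n h => ?_) n
  rw [pow_suc]
  exact add_lt_add_of_lt_of_le h (suc_le_iff.2 ((Model.zero_le n).trans_lt h) |>.trans' (by simp))

theorem pow_pos (n : M.C o) : 0 < M.pow n := (Model.zero_le n).trans_lt (lt_pow n)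

theorem pow_add (m n : M.C o) : M.pow (m + n) = M.pow m * M.pow n := by
  refine (QFPred.eq (f := fun n => M.pow (m + n)) (g := fun n => M.pow m * M.pow n)
    (by fun_prop) (by fun_prop)).induction (by simp) (fun n h => ?_) n
  rw [← add_assoc, pow_suc, h, pow_suc, mul_add]

/-- The pairing `(s, t) ↦ (s + t)² + s`. -/
def pr (s t : M.C o) : M.C o := (s + t) * (s + t) + s

omit [M.IsACA] in
theorem eval_pair (e : M.Env) (s t : Tm o) : (pair s t).eval e = pr (s.eval e) (t.eval e) := rfl

/-- The value lies in the interval from `(s + t)²` up to, but excluding, `(s + t + 1)²`, so it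
determines `s + t`, and then `s` by cancellation. -/
theorem pr_inj {s t s' t' : M.C o} : pr s t = pr s' t' ↔ s = s' ∧ t = t' := by
  refine ⟨fun h => ?_, fun h => by rw [h.1, h.2]⟩
  have key : ∀ s t s' t' : M.C o, s + t < s' + t' → pr s t < pr s' t' := by
    intro s t s' t' h
    calc pr s t ≤ (s + t) * (s + t) + (s + t) := by
          rw [pr]
          gcongr
          exact le_self_add
      _ < (s + t + 1) * (s + t + 1) := by
          have : (s + t + 1) * (s + t + 1) = (s + t) * (s + t) + (s + t) + (s + t + 1) := by ring
          rw [this]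
          exact lt_add_of_pos_right _ (suc_pos _)
      _ ≤ (s' + t') * (s' + t') := by
          have := suc_le_iff.2 h
          gcongr
      _ ≤ pr s' t' := le_self_add
  have hu : s + t = s' + t' := by
    rcases lt_trichotomy (s + t) (s' + t') with h' | h' | h'
    · exact ((key _ _ _ _ h').ne h).elim
    · exact h'
    · exact ((key _ _ _ _ h').ne' h).elim
  rw [pr, pr, hu] at h
  obtain rfl := add_left_cancel h
  exact ⟨rfl, add_left_cancel hu⟩

/-- The code of the rational number `(a - b) / (d + 1)`. -/
def code (a b d : M.C o) : M.C o := pr (pr a b) d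

omit [M.IsACA] in
theorem eval_ratCode (e : M.Env) (a b d : Tm o) :
    (ratCode a b d).eval e = code (a.eval e) (b.eval e) (d.eval e) := rfl

theorem code_inj {a b d a' b' d' : M.C o} :
    code a b d = code a' b' d' ↔ a = a' ∧ b = b' ∧ d = d' := by
  rw [code, code, pr_inj, pr_inj, and_assoc]

/-- The numbers `p` and `q` are codes of rational numbers with `p ≤ q + u / v`. -/
def RatLe (p q u v : M.C o) : Prop :=
  ∃ a b d a₁ b₁ d₁ : M.C o, p = code a b d ∧ q = code a₁ b₁ d₁ ∧
    v * (a * (d₁ + 1) + b₁ * (d + 1)) ≤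
      v * (a₁ * (d + 1) + b * (d₁ + 1)) + u * ((d + 1) * (d₁ + 1))

omit [M.IsACA] in
theorem eval_wk_six (t : Tm o) (x₁ x₂ x₃ x₄ x₅ x₆ : M.C o) (e : M.Env) :
    (t.wk o 6).eval (Env.cons x₁ (Env.cons x₂ (Env.cons x₃ (Env.cons x₄ (Env.cons x₅
      (Env.cons x₆ e)))))) = t.eval e := by
  rw [Tm.eval_wk_add_one, Tm.eval_wk_add_one, Tm.eval_wk_add_one, Tm.eval_wk_add_one,
    Tm.eval_wk_add_one, Tm.eval_wk]

omit [M.IsACA] in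
theorem eval_wk_two {τ : Ty} (t : Tm τ) (x₁ x₂ : M.C o) (e : M.Env) :
    (t.wk o 2).eval (Env.cons x₁ (Env.cons x₂ e)) = t.eval e := by
  rw [Tm.eval_wk_add_one, Tm.eval_wk]

theorem eval_ratLeAdd (e : M.Env) (p q u k : Tm o) :
    (ratLeAdd p q u k).eval e ↔
      RatLe (p.eval e) (q.eval e) (u.eval e) (M.pow (k.eval e)) := by
  simp only [ratLeAdd, Fml.eval_ex, Fml.eval_and, Fml.eval_eq, Fml.eval_le, eval_wk_six,
    eval_ratCode, eval_times, eval_plus, eval_suc, eval_pow2]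
  rfl

/-- The object `x` represents a real number. -/
def IsReal (x : M.C t1) : Prop := ∀ k i : M.C o,
  RatLe (x k) (x (k + i)) 1 (M.pow k) ∧ RatLe (x (k + i)) (x k) 1 (M.pow k)

/-- The order of real numbers. -/
def RealLe (x y : M.C t1) : Prop := ∀ k : M.C o, RatLe (x k) (y k) (1 + 1) (M.pow k)

theorem eval_inReal (e : M.Env) (x : Tm t1) : (inReal x).eval e ↔ IsReal (x.eval e) := by
  simp only [inReal, Fml.eval_all, Fml.eval_and, eval_ratLeAdd, Tm.eval, eval_wk_two]
  rfl

theorem eval_leReal (e : M.Env) (x y : Tm t1) :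
    (leReal x y).eval e ↔ RealLe (x.eval e) (y.eval e) := by
  simp only [leReal, Fml.eval_all, eval_ratLeAdd, Tm.eval, Tm.eval_wk]
  rfl

theorem eval_eqReal (e : M.Env) (x y : Tm t1) :
    (eqReal x y).eval e ↔ RealLe (x.eval e) (y.eval e) ∧ RealLe (y.eval e) (x.eval e) := by
  rw [eqReal, Fml.eval_and, eval_leReal, eval_leReal]

/-! The order of codes of rational numbers. -/

namespace RatLe

variable {p q r u v u' v' : M.C o}

/-- The condition `h'` is `u / v ≤ u' / v'` with denominators cleared. -/
theorem mono (h : RatLe p q u v) (hv : 0 < v) (h' : u * v' ≤ u' * v) : RatLe p q u' v' := by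
  obtain ⟨a, b, d, a₁, b₁, d₁, rfl, rfl, h⟩ := h
  refine ⟨a, b, d, a₁, b₁, d₁, rfl, rfl, le_of_mul_le_mul_left ?_ hv⟩
  calc v * (v' * (a * (d₁ + 1) + b₁ * (d + 1)))
      = v' * (v * (a * (d₁ + 1) + b₁ * (d + 1))) := by ring
    _ ≤ v' * (v * (a₁ * (d + 1) + b * (d₁ + 1)) + u * ((d + 1) * (d₁ + 1))) := by gcongr
    _ = v * (v' * (a₁ * (d + 1) + b * (d₁ + 1))) + (u * v') * ((d + 1) * (d₁ + 1)) := by ring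
    _ ≤ v * (v' * (a₁ * (d + 1) + b * (d₁ + 1))) + (u' * v) * ((d + 1) * (d₁ + 1)) := by gcongr
    _ = _ := by ring

theorem trans (h : RatLe p q u v) (h' : RatLe q r u' v') :
    RatLe p r (u * v' + u' * v) (v * v') := by
  obtain ⟨a, b, d, a₁, b₁, d₁, rfl, rfl, h⟩ := h
  obtain ⟨a₁', b₁', d₁', a₂, b₂, d₂, e, rfl, h'⟩ := h'
  obtain ⟨rfl, rfl, rfl⟩ := code_inj.1 e
  refine ⟨a, b, d, a₂, b₂, d₂, rfl, rfl, le_of_mul_le_mul_left ?_ (suc_pos d₁)⟩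
  -- A semiring has no subtraction, so the terms of the intermediate rational, which would cancel,
  -- are added to both sides.
  refine le_of_add_le_add_right
    (a := v * v' * ((d + 1) * (d₂ + 1)) * (a₁ + b₁)) ?_
  calc _ = v' * (d₂ + 1) * (v * (a * (d₁ + 1) + b₁ * (d + 1))) +
        v * (d + 1) * (v' * (a₁ * (d₂ + 1) + b₂ * (d₁ + 1))) := by ring
    _ ≤ v' * (d₂ + 1) * (v * (a₁ * (d + 1) + b * (d₁ + 1)) + u * ((d + 1) * (d₁ + 1))) +
        v * (d + 1) * (v' * (a₂ * (d₁ + 1) + b₁ * (d₂ + 1)) + u' * ((d₁ + 1) * (d₂ + 1))) := by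
      gcongr
    _ = _ := by ring

/-- The order of the rational numbers is archimedean. -/
theorem of_forall_pow
    (h : ∀ n : M.C o, RatLe p q (u * M.pow n + u' * v) (v * M.pow n)) : RatLe p q u v := by
  obtain ⟨a, b, d, a₁, b₁, d₁, rfl, rfl, -⟩ := h 0
  refine ⟨a, b, d, a₁, b₁, d₁, rfl, rfl, ?_⟩
  by_contra! hlt
  -- If the bound failed, it would fail by at least 1, and scaling by `2 ^ n` would give `2 ^ n ≤ u'
  -- * v * ((d + 1) * (d₁ + 1))`. Taking that right side as `n` contradicts `lt_pow`.
  set n := u' * v * ((d + 1) * (d₁ + 1))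
  obtain ⟨a', b', d', a₁', b₁', d₁', e, e', h⟩ := h n
  obtain ⟨rfl, rfl, rfl⟩ := code_inj.1 e
  obtain ⟨rfl, rfl, rfl⟩ := code_inj.1 e'
  refine (lt_pow n).not_ge (le_of_add_le_add_left (a := M.pow n *
    (v * (a₁ * (d + 1) + b * (d₁ + 1)) + u * ((d + 1) * (d₁ + 1)))) ?_)
  calc _ = M.pow n *
        (v * (a₁ * (d + 1) + b * (d₁ + 1)) + u * ((d + 1) * (d₁ + 1)) + 1) := by ring
    _ ≤ M.pow n * (v * (a * (d₁ + 1) + b₁ * (d + 1))) := by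
      have := suc_le_iff.2 hlt
      gcongr
    _ = v * M.pow n * (a * (d₁ + 1) + b₁ * (d + 1)) := by ring
    _ ≤ _ := h
    _ = _ := by
      simp only [n]
      ring

/-- For every code `q` of a rational number and every `v > 0` there is a code of `q + 1 / v`. -/
theorem exists_add_inv (h : RatLe q r u' v') (hv : 0 < v) : ∃ s, ∀ p u w,
    RatLe p s u w ↔ RatLe p q (u * v + w) (w * v) := by
  obtain ⟨a, b, d, -, -, -, rfl, -, -⟩ := h
  obtain ⟨m, rfl⟩ := exists_eq_suc_of_pos hv
  have hd : ((d + 1) * (m + 1) : M.C o) = (d * m + d + m) + 1 := by ring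
  refine ⟨code (a * (m + 1) + (d + 1)) (b * (m + 1)) (d * m + d + m), fun p u w => ?_⟩
  have key : ∀ a₀ b₀ d₀ : M.C o,
      (w * (a₀ * (d * m + d + m + 1) + b * (m + 1) * (d₀ + 1)) ≤
        w * ((a * (m + 1) + (d + 1)) * (d₀ + 1) + b₀ * (d * m + d + m + 1)) +
          u * ((d₀ + 1) * (d * m + d + m + 1))) ↔
      w * (m + 1) * (a₀ * (d + 1) + b * (d₀ + 1)) ≤
        w * (m + 1) * (a * (d₀ + 1) + b₀ * (d + 1)) +
          (u * (m + 1) + w) * ((d₀ + 1) * (d + 1)) := fun a₀ b₀ d₀ => by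
    rw [← hd]
    apply iff_of_eq
    congr 1 <;> ring
  constructor
  · rintro ⟨a₀, b₀, d₀, a₁, b₁, d₁, rfl, e, h⟩
    obtain ⟨rfl, rfl, rfl⟩ := code_inj.1 e
    exact ⟨a₀, b₀, d₀, a, b, d, rfl, rfl, (key _ _ _).1 h⟩
  · rintro ⟨a₀, b₀, d₀, a₁, b₁, d₁, rfl, e, h⟩
    obtain ⟨rfl, rfl, rfl⟩ := code_inj.1 e
    exact ⟨a₀, b₀, d₀, _, _, _, rfl, rfl, (key _ _ _).2 h⟩

end RatLe

end Model

end HORM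

/-! ### The four spaces and the maps between them. -/

namespace HORM

open Ty Model

/-- A term with value `1` if `φ` holds and `0` otherwise, for arithmetical `φ`, provided that the
variable `0` of type `2` denotes a functional as in `(∃²)`. -/
def Fml.indicator (φ : Fml) : Tm o := subTm ⬝ .one ⬝ φ.char

namespace Model

variable {M : Model} [M.IsACA]

open Classical in
theorem eval_indicator {φ : Fml} (hφ : φ.Arith) {e : M.Env} (he : IsExistsTwo (e t2 0)) :
    φ.indicator.eval e = if φ.eval e then 1 else 0 := by
  rw [Fml.indicator, eval_subTm, eval_one]
  split_ifs with h
  · rw [(eval_char hφ he).2 h, sub_zero]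
  · rw [one_sub_eq_zero_iff, Ne, eval_char hφ he]
    exact h

/-! Injections to the natural numbers. -/

/-- There is an injection to the natural numbers from the space with the points `D` and the
equality `E`. -/
def Injects (D : M.C t1 → Prop) (E : M.C t1 → M.C t1 → Prop) : Prop :=
  ∃ Y : M.C t2, (∀ x y, D x → D y → E x y → Y x = Y y) ∧ ∀ x y, D x → D y → Y x = Y y → E x y

omit [M.IsACA] in
theorem eval_noInjection {D : Tm t1 → Fml} {E : Tm t1 → Tm t1 → Fml} {D' : M.C t1 → Prop}
    {E' : M.C t1 → M.C t1 → Prop} (hD : ∀ e x, (D x).eval e ↔ D' (x.eval e))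
    (hE : ∀ e x y, (E x y).eval e ↔ E' (x.eval e) (y.eval e)) (e : M.Env) :
    (noInjection D E).eval e ↔ ¬ Injects D' E' := by
  simp only [noInjection, Injects, Fml.eval_neg, Fml.eval_ex, Fml.eval_and, Fml.eval_all,
    Fml.eval_imp, Fml.eval_eq, hD, hE, Tm.eval, Env.cons_zero,
    Env.cons_ne (show t1 ≠ t2 by decide)]
  rfl

/-- Pulling back an injection along a map of spaces. -/
theorem Injects.comap {D D' : M.C t1 → Prop} {E E' : M.C t1 → M.C t1 → Prop}
    (h : Injects D' E') (F : M.C (t1 ⇒ t1)) (hD : ∀ x, D x → D' (F x))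
    (hE : ∀ x y, D x → D y → (E x y ↔ E' (F x) (F y))) : Injects D E := by
  obtain ⟨Y, h₁, h₂⟩ := h
  refine ⟨M.comS t1 t1 o (M.comK t2 t1 Y) F, fun x y hx hy h => ?_, fun x y hx hy h => ?_⟩
  · simpa using h₁ _ _ (hD x hx) (hD y hy) ((hE x y hx hy).1 h)
  · exact (hE x y hx hy).2 (h₂ _ _ (hD x hx) (hD y hy) (by simpa using h))

/-- The object `f` is an element of Cantor space. -/
def IsCantor (f : M.C t1) : Prop := ∀ n : M.C o, f n ≤ 1

/-- The object `x` represents a real number in the unit interval. -/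
def IsUnit (x : M.C t1) : Prop :=
  IsReal x ∧ RealLe (M.comK o o (code 0 0 0)) x ∧ RealLe x (M.comK o o (code 1 0 0))

/-- The equality of real numbers. -/
def RealEq (x y : M.C t1) : Prop := RealLe x y ∧ RealLe y x

theorem eval_inCantor (e : M.Env) (f : Tm t1) : (inCantor f).eval e ↔ IsCantor (f.eval e) := by
  simp only [inCantor, Fml.eval_all, Fml.eval_le, Tm.eval, Tm.eval_wk]
  rfl

theorem eval_inUnit (e : M.Env) (x : Tm t1) : (inUnit x).eval e ↔ IsUnit (x.eval e) := by
  simp only [inUnit, Fml.eval_and, eval_inReal, eval_leReal]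
  rfl

theorem eval_NIN (e : M.Env) : NIN.eval e ↔ ¬ Injects (M := M) IsUnit RealEq :=
  eval_noInjection eval_inUnit eval_eqReal e

theorem eval_NINReal (e : M.Env) : NINReal.eval e ↔ ¬ Injects (M := M) IsReal RealEq :=
  eval_noInjection eval_inReal eval_eqReal e

theorem eval_NINCantor (e : M.Env) : NINCantor.eval e ↔ ¬ Injects (M := M) IsCantor Eq :=
  eval_noInjection eval_inCantor (fun e => eval_eqAt e) e

omit [M.IsACA] in
theorem eval_NINBaire (e : M.Env) :
    NINBaire.eval e ↔ ¬ Injects (M := M) (fun _ => True) Eq :=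
  eval_noInjection (fun _ _ => iff_of_true id trivial) (fun e => eval_eqAt e) e

/-! From the unit interval to the real line. -/

theorem injects_unit (h : Injects (M := M) IsReal RealEq) : Injects (M := M) IsUnit RealEq := by
  obtain ⟨Y, h₁, h₂⟩ := h
  exact ⟨Y, fun x y hx hy => h₁ x y hx.1 hy.1, fun x y hx hy => h₂ x y hx.1 hy.1⟩

/-! From Baire space to Cantor space: the characteristic function of the graph. -/

variable (M) in
open Classical in
theorem exists_graph : ∃ F : M.C (t1 ⇒ t1), ∀ f p,
    F f p = if ∃ n : M.C o, pr n (f n) = p then 1 else 0 := by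
  obtain ⟨Φ, hΦ⟩ := exists_existsTwo M
  let φ : Fml := .ex o (.eq (pair (.var o 0) (.var t1 0 ⬝ .var o 0)) (.var o 1))
  have hφ : φ.Arith := by simp [φ, Fml.Arith, Fml.ex, Fml.neg]
  refine ⟨((φ.indicator.abs o).abs t1).eval (Env.cons Φ default), fun f p => ?_⟩
  have h02 : o ≠ t2 := by decide
  have h12 : t1 ≠ t2 := by decide
  have h01 : o ≠ t1 := by decide
  rw [Tm.eval_abs, Tm.eval_abs, eval_indicator hφ
    (by rwa [Env.cons_ne h02, Env.cons_ne h12, Env.cons_zero])]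
  congr 1
  simp only [φ, Fml.eval_ex, Fml.eval_eq, eval_pair, Tm.eval, Env.cons_zero, Env.cons_ne h01]
  rfl

theorem injects_baire (h : Injects (M := M) IsCantor Eq) :
    Injects (M := M) (fun _ => True) Eq := by
  obtain ⟨F, hF⟩ := exists_graph M
  refine h.comap F (fun f _ p => ?_) fun f g _ _ => ⟨fun h => by rw [h], fun h => ?_⟩
  · rw [hF]
    split_ifs
    · rfl
    · exact Model.zero_le 1
  · refine M.ext _ _ fun n => ?_
    have h₁ : F f (pr n (f n)) = 1 := by rw [hF, if_pos ⟨n, rfl⟩]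
    rw [h, hF] at h₁
    split_ifs at h₁ with h₂
    · obtain ⟨m, hm⟩ := h₂
      obtain ⟨rfl, h₃⟩ := pr_inj.1 hm
      exact h₃.symm
    · exact (zero_ne_one h₁).elim

/-! From the real line to Baire space: the set of the rational upper bounds. -/

/-- The number `p` is the code of a rational upper bound of the real number `x`. -/
def UpperBound (x : M.C t1) (p : M.C o) : Prop := ∀ k : M.C o, RatLe (x k) p 1 (M.pow k)

variable (M) in
open Classical in
theorem exists_upperBounds : ∃ F : M.C (t1 ⇒ t1), ∀ x p,
    F x p = if UpperBound x p then 1 else 0 := by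
  obtain ⟨Φ, hΦ⟩ := exists_existsTwo M
  let φ : Fml := .all o (ratLeAdd (.var t1 0 ⬝ .var o 0) (.var o 1) .one (.var o 0))
  have hφ : φ.Arith := by
    simp [φ, ratLeAdd, Fml.Arith, Fml.ex, Fml.neg, Fml.and, Fml.le, Fml.or]
  refine ⟨((φ.indicator.abs o).abs t1).eval (Env.cons Φ default), fun f p => ?_⟩
  have h02 : o ≠ t2 := by decide
  have h12 : t1 ≠ t2 := by decide
  have h01 : o ≠ t1 := by decide
  rw [Tm.eval_abs, Tm.eval_abs, eval_indicator hφ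
    (by rwa [Env.cons_ne h02, Env.cons_ne h12, Env.cons_zero])]
  congr 1
  simp only [φ, Fml.eval_all, eval_ratLeAdd, Tm.eval, Env.cons_zero, Env.cons_ne h01]
  rfl

theorem one_le_pow (n : M.C o) : 1 ≤ M.pow n := by
  simpa using suc_le_iff.2 (pow_pos n)

/-- Passing through index `k + n` gives `x(k) ≤ p + 2^(-k) + 3 · 2^(-(k+n))`: one error each from
regularity of `x` and from the bound on `y`, and two from the comparison of the reals. The
archimedean property removes the part depending on `n`, which explains the constant 3. -/
theorem UpperBound.of_realLe {x y : M.C t1} {p : M.C o} (h : UpperBound y p) (hx : IsReal x)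
    (hxy : RealLe x y) : UpperBound x p := fun k => by
  refine RatLe.of_forall_pow (u' := 1 + 1 + 1) fun n => ?_
  refine (((hx k n).1.trans (hxy (k + n))).trans (h (k + n))).mono
    (by have := pow_pos k; have := pow_pos (k + n); positivity) ?_
  rw [pow_add]
  calc _ = M.pow k * M.pow k * M.pow k * M.pow n * M.pow n * (M.pow n + (1 + 1 + 1) * 1) := by
        ring
    _ ≤ M.pow k * M.pow k * M.pow k * M.pow n * M.pow n *
        (M.pow n + (1 + 1 + 1) * M.pow k) := by
      have := one_le_pow k
      gcongr
    _ = _ := by ring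

/-- The rational `y(k) + 2^(-k)` bounds `y`, hence `x`, and evaluating that bound at `k` gives
exactly the tolerance `2 · 2^(-k)` of the order. -/
theorem realLe_of_upperBound {x y : M.C t1} (hy : IsReal y)
    (h : ∀ p, UpperBound y p → UpperBound x p) : RealLe x y := fun k => by
  obtain ⟨s, hs⟩ := (hy k 0).1.exists_add_inv (pow_pos k)
  have hys : UpperBound y s := fun n => by
    rw [hs]
    rcases le_total n k with hn | hn <;> obtain ⟨i, rfl⟩ := exists_add_of_le hn
    · refine (hy n i).1.mono (pow_pos n) ?_
      calc _ = 0 + M.pow (n + i) * M.pow n := by ring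
        _ ≤ M.pow n * M.pow n + M.pow (n + i) * M.pow n := by gcongr; exact Model.zero_le _
        _ = _ := by ring
    · refine (hy k i).2.mono (pow_pos k) ?_
      calc _ = 0 + M.pow (k + i) * M.pow k := by ring
        _ ≤ M.pow k * M.pow k + M.pow (k + i) * M.pow k := by gcongr; exact Model.zero_le _
        _ = _ := by ring
  refine ((hs _ _ _).1 (h s hys k)).mono (mul_pos (pow_pos k) (pow_pos k)) (le_of_eq ?_)
  ring

theorem injects_real (h : Injects (M := M) (fun _ => True) Eq) :
    Injects (M := M) IsReal RealEq := by
  obtain ⟨F, hF⟩ := exists_upperBounds M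
  refine h.comap F (fun _ _ => trivial) fun x y hx hy => ⟨fun h => ?_, fun h => ?_⟩
  · refine M.ext _ _ fun p => ?_
    rw [hF, hF]
    congr 1
    exact propext ⟨fun hp => hp.of_realLe hy h.2, fun hp => hp.of_realLe hx h.1⟩
  · have key : ∀ p, UpperBound x p ↔ UpperBound y p := fun p => by
      have := congrArg (fun z : M.C t1 => z p) h
      simp only [hF] at this
      split_ifs at this <;> simp_all
    exact ⟨realLe_of_upperBound hy fun p => (key p).2, realLe_of_upperBound hx fun p => (key p).1⟩

/-! From Cantor space to the unit interval: `f ↦ ∑ f(n) / 4 ^ (n + 1)`. -/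

/-- The term `λ n r. 4 r + t`, where `n` is the variable `1` of type `o` in `t`. -/
def stepTm (t : Tm o) : Tm (o ⇒ o ⇒ o) :=
  ((plus (plus (plus (.var o 0) (.var o 0)) (plus (.var o 0) (.var o 0))) t).abs o).abs o

/-- A term for the numerators of the partial sums of `∑ f(n) / 4 ^ (n + 1)`, where `f` is the
variable `0` of type `1`. -/
def numTm : Tm t1 := Tm.recO ⬝ stepTm (.var t1 0 ⬝ .var o 1) ⬝ .zero

/-- A closed term for `n ↦ 4 ^ n - 1`. -/
def denTm : Tm t1 := Tm.recO ⬝ stepTm (plus .one (plus .one .one)) ⬝ .zero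

/-- The numerators of the partial sums of `∑ f(n) / 4 ^ (n + 1)`. -/
def num (f : M.C t1) : M.C t1 := numTm.eval (Env.cons f default)

variable (M) in
/-- The function `n ↦ 4 ^ n - 1`. -/
def den : M.C t1 := denTm.eval default

@[simp] theorem num_zero (f : M.C t1) : num f (0 : M.C o) = 0 := recO_zero _ _

theorem num_suc (f : M.C t1) (k : M.C o) :
    num f (k + 1) = num f k + num f k + (num f k + num f k) + f k := by
  refine (recO_suc _ _ _).trans ?_
  change (stepTm _).eval _ k (num f k) = _
  rw [stepTm, Tm.eval_abs, Tm.eval_abs]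
  simp only [eval_plus, Tm.eval, Env.cons_zero, Env.cons_ne (show o ≠ t1 by decide)]
  rw [show (1 : ℕ) = 0 + 1 from rfl, Env.cons_succ, Env.cons_zero]

theorem den_add_one (k : M.C o) : M.den k + 1 = M.pow k * M.pow k := by
  refine (QFPred.eq (f := fun k => M.den k + 1) (g := fun k => M.pow k * M.pow k)
    (by fun_prop) (by fun_prop)).induction ?_ (fun k h => ?_) k
  · rw [den, denTm]
    exact (congrArg (· + 1) (recO_zero _ _)).trans (by simp [eval_zero])
  · have : M.den (k + 1) = M.den k + M.den k + (M.den k + M.den k) + (1 + (1 + 1)) := by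
      refine (recO_suc _ _ _).trans ?_
      change (stepTm _).eval _ k (M.den k) = _
      rw [stepTm, Tm.eval_abs, Tm.eval_abs]
      rfl
    rw [this, pow_suc]
    calc _ = (1 + 1) * (1 + 1) * (M.den k + 1) := by ring
      _ = _ := by rw [h]; ring

theorem num_lower (f : M.C t1) (k i : M.C o) :
    M.pow i * M.pow i * num f k ≤ num f (k + i) := by
  refine (QFPred.le (f := fun i => M.pow i * M.pow i * num f k) (g := fun i => num f (k + i))
    (by fun_prop) (by fun_prop)).induction (by simp) (fun i h => ?_) i
  rw [← add_assoc, num_suc, pow_suc]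
  calc _ = M.pow i * M.pow i * num f k + M.pow i * M.pow i * num f k +
        (M.pow i * M.pow i * num f k + M.pow i * M.pow i * num f k) := by ring
    _ ≤ num f (k + i) + num f (k + i) + (num f (k + i) + num f (k + i)) := by gcongr
    _ ≤ _ := le_self_add

/-- After division by `3 · 4^(k+i)`, this says that the partial sum plus its largest possible tail
`1 / (3 · 4^k)` does not increase with the index. -/
theorem num_upper {f : M.C t1} (hf : IsCantor f) (k i : M.C o) :
    (1 + 1 + 1) * num f (k + i) + 1 ≤ M.pow i * M.pow i * ((1 + 1 + 1) * num f k + 1) := by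
  refine (QFPred.le (f := fun i => (1 + 1 + 1) * num f (k + i) + 1)
    (g := fun i => M.pow i * M.pow i * ((1 + 1 + 1) * num f k + 1))
    (by fun_prop) (by fun_prop)).induction (by simp) (fun i h => ?_) i
  rw [← add_assoc, num_suc, pow_suc]
  calc _ = (1 + 1) * (1 + 1) * ((1 + 1 + 1) * num f (k + i)) + (1 + 1 + 1) * f (k + i) + 1 := by
        ring
    _ ≤ (1 + 1) * (1 + 1) * ((1 + 1 + 1) * num f (k + i)) + (1 + 1 + 1) * 1 + 1 := by
      have := hf (k + i)
      gcongr
    _ = (1 + 1) * (1 + 1) * ((1 + 1 + 1) * num f (k + i) + 1) := by ring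
    _ ≤ (1 + 1) * (1 + 1) * (M.pow i * M.pow i * ((1 + 1 + 1) * num f k + 1)) := by gcongr
    _ = _ := by ring

variable (M) in
theorem exists_sum : ∃ F : M.C (t1 ⇒ t1), ∀ f k, F f k = code (num f k) 0 (M.den k) := by
  refine ⟨(((ratCode (numTm ⬝ .var o 0) .zero (denTm ⬝ .var o 0)).abs o).abs t1).eval default,
    fun f k => ?_⟩
  rw [Tm.eval_abs, Tm.eval_abs, eval_ratCode]
  -- The term ignores the added number variable; both values obey the same recursion, so induction
  -- identifies them.
  have h : numTm.eval (Env.cons k (Env.cons f default)) = num f := by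
    refine M.ext _ _ fun n => ?_
    refine (QFPred.eq (f := fun n => numTm.eval (Env.cons k (Env.cons f default)) n)
      (g := fun n => num f n) (by fun_prop) (by fun_prop)).induction ?_ (fun n h => ?_) n
    · exact (recO_zero _ _).trans (num_zero f).symm
    · rw [num_suc, ← h]
      refine (recO_suc _ _ _).trans ?_
      change (stepTm _).eval _ n (numTm.eval (Env.cons k (Env.cons f default)) n) = _
      rw [stepTm, Tm.eval_abs, Tm.eval_abs]
      simp only [eval_plus, Tm.eval, Env.cons_zero, Env.cons_ne (show o ≠ t1 by decide)]
      rw [show (1 : ℕ) = 0 + 1 from rfl, Env.cons_succ, Env.cons_zero]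
  simp only [Tm.eval, h, Env.cons_zero]
  rfl

section sum

variable {F : M.C (t1 ⇒ t1)} (hF : ∀ f k, F f k = code (num f k) 0 (M.den k))
include hF

/-- Partial sums increase, and beyond index `k` they gain at most `4^(-k)`, which is below `2^(-k)`.
-/
theorem isReal_sum {f : M.C t1} (hf : IsCantor f) : IsReal (F f) := fun k i => by
  rw [hF, hF]
  refine ⟨⟨_, _, _, _, _, _, rfl, rfl, ?_⟩, ⟨_, _, _, _, _, _, rfl, rfl, ?_⟩⟩ <;>
  rw [den_add_one, den_add_one, pow_add]
  · calc _ = M.pow k * M.pow k * M.pow k * (M.pow i * M.pow i * num f k) := by ring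
      _ ≤ M.pow k * M.pow k * M.pow k * num f (k + i) := by
        have := num_lower f k i
        gcongr
      _ = M.pow k * (num f (k + i) * (M.pow k * M.pow k) +
          0 * (M.pow k * M.pow i * (M.pow k * M.pow i))) := by ring
      _ ≤ _ := le_self_add
  · have h₁ : num f (k + i) ≤ M.pow i * M.pow i * (num f k + 1) := by
      refine le_of_mul_le_mul_left ?_ (show (0 : M.C o) < 1 + 1 + 1 from suc_pos _)
      calc _ ≤ (1 + 1 + 1) * num f (k + i) + 1 := le_self_add
        _ ≤ M.pow i * M.pow i * ((1 + 1 + 1) * num f k + 1) := num_upper hf k i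
        _ ≤ M.pow i * M.pow i * ((1 + 1 + 1) * num f k + 1) + M.pow i * M.pow i * (1 + 1) :=
          le_self_add
        _ = _ := by ring
    calc _ = M.pow k * M.pow k * M.pow k * num f (k + i) := by ring
      _ ≤ M.pow k * M.pow k * M.pow k * (M.pow i * M.pow i * (num f k + 1)) := by gcongr
      _ = M.pow k * (num f k * (M.pow k * M.pow i * (M.pow k * M.pow i))) +
          1 * (M.pow k * M.pow k * M.pow k * (M.pow i * M.pow i)) := by ring
      _ ≤ M.pow k * (num f k * (M.pow k * M.pow i * (M.pow k * M.pow i))) +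
          M.pow k * (M.pow k * M.pow k * M.pow k * (M.pow i * M.pow i)) := by
        have := one_le_pow k
        gcongr
      _ = _ := by ring

theorem isUnit_sum {f : M.C t1} (hf : IsCantor f) : IsUnit (F f) := by
  refine ⟨isReal_sum hF hf, fun k => ?_, fun k => ?_⟩ <;> rw [hF, comK_apply] <;>
  refine ⟨_, _, _, _, _, _, rfl, rfl, ?_⟩ <;> rw [den_add_one]
  · simp
  · have h := num_upper hf 0 k
    rw [zero_add, num_zero, mul_zero, zero_add, mul_one] at h
    refine le_trans ?_ le_self_add
    have h' : num f k ≤ M.pow k * M.pow k :=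
      calc num f k = 1 * num f k := (one_mul _).symm
        _ ≤ (1 + 1 + 1) * num f k := by gcongr; exact le_add_self
        _ ≤ _ := le_self_add.trans h
    calc _ = M.pow k * num f k := by ring
      _ ≤ M.pow k * (M.pow k * M.pow k) := by gcongr
      _ = _ := by ring

/-- With a common partial sum before `k`, the digit 1 of `g` contributes `4^(-(k+1))`, while the
later digits of `f` contribute at most a third of that. The sums differ by at least `2 / (3 ·
4^(k+1))`. At index `2k + 4` the order tolerates only `1 / (2 · 4^(k+1))`, which is smaller. -/
theorem not_realLe_sum {f g : M.C t1} {k : M.C o} (hf : IsCantor f) (hk : num f k = num g k)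
    (h₀ : f k = 0) (h₁ : g k = 1) : ¬ RealLe (F g) (F f) := fun h => by
  obtain ⟨a, b, d, a₁, b₁, d₁, e, e₁, h⟩ := h (k + 1 + (k + 1 + 1 + 1))
  rw [hF] at e e₁
  obtain ⟨rfl, rfl, rfl⟩ := code_inj.1 e
  obtain ⟨rfl, rfl, rfl⟩ := code_inj.1 e₁
  have hu := num_upper hf (k + 1) (k + 1 + 1 + 1)
  have hl := num_lower g (k + 1) (k + 1 + 1 + 1)
  rw [num_suc, h₀, hk] at hu
  rw [num_suc, h₁] at hl
  rw [den_add_one, pow_add (k + 1)] at h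
  have hq : M.pow (k + 1 + 1 + 1) = (1 + 1) * (1 + 1) * M.pow (k + 1) := by
    rw [pow_suc, pow_suc (k + 1)]
    ring
  set p := M.pow (k + 1)
  set q := M.pow (k + 1 + 1 + 1)
  have hp : 0 < p := pow_pos _
  have hq' : 0 < q := pow_pos _
  have h' : num g (k + 1 + (k + 1 + 1 + 1)) ≤
      num f (k + 1 + (k + 1 + 1 + 1)) + (1 + 1) * (p * q) := by
    refine le_of_mul_le_mul_left ?_ (show 0 < p * q * (p * q * (p * q)) by positivity)
    calc _ = _ := by ring
      _ ≤ _ := h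
      _ = _ := by ring
  have : (1 + 1 + 1) * (q * q * (num g k + num g k + (num g k + num g k) + 1)) + 1 ≤
      q * q * ((1 + 1 + 1) * (num g k + num g k + (num g k + num g k) + 0) + 1) +
        (1 + 1 + 1) * ((1 + 1) * (p * q)) :=
    calc _ ≤ (1 + 1 + 1) * (num f (k + 1 + (k + 1 + 1 + 1)) + (1 + 1) * (p * q)) + 1 := by
          have := hl.trans h'
          gcongr
      _ = ((1 + 1 + 1) * num f (k + 1 + (k + 1 + 1 + 1)) + 1) +
          (1 + 1 + 1) * ((1 + 1) * (p * q)) := by ring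
      _ ≤ _ := by gcongr
  rw [hq] at this
  refine this.not_gt ?_
  calc _ = p ^ 2 * 40 + p ^ 2 * num g k * 192 := by ring
    _ < p ^ 2 * 40 + p ^ 2 * num g k * 192 + (p ^ 2 * 8 + 1) :=
      lt_add_of_pos_right _ (suc_pos _)
    _ = _ := by ring

theorem injects_cantor_of_sum (h : Injects (M := M) IsUnit RealEq) :
    Injects (M := M) IsCantor Eq := by
  refine h.comap F (fun f hf => isUnit_sum hF hf) fun f g hf hg => ⟨?_, fun h => ?_⟩
  · rintro rfl
    have : RealLe (F f) (F f) := fun k => by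
      have := (isReal_sum hF hf k 0).1
      rw [add_zero] at this
      refine this.mono (pow_pos k) ?_
      gcongr
      exact le_self_add
    exact ⟨this, this⟩
  · have cases_cantor : ∀ {f : M.C t1}, IsCantor f → ∀ k : M.C o, f k = 0 ∨ f k = 1 :=
      fun {f} hf k => by
        rcases (hf k).lt_or_eq with h | h
        · rw [← zero_add 1, lt_suc_iff] at h
          exact .inl (le_antisymm h (Model.zero_le _))
        · exact .inr h
    have step : ∀ k : M.C o, num f k = num g k → f k = g k := fun k hk => by
      rcases cases_cantor hf k with h₀ | h₀ <;> rcases cases_cantor hg k with h₁ | h₁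
      · rw [h₀, h₁]
      · exact (not_realLe_sum hF hf hk h₀ h₁ h.2).elim
      · exact (not_realLe_sum hF hg hk.symm h₁ h₀ h.1).elim
      · rw [h₀, h₁]
    -- Agreement of all digits below `k` would involve a quantifier; equality of the partial sums is
    -- a quantifier-free substitute that suffices for `step`.
    have key : ∀ k : M.C o, num f k = num g k :=
      (QFPred.eq (f := fun k => num f k) (g := fun k => num g k)
        (by fun_prop) (by fun_prop)).induction (by simp) fun k hk => by
          rw [num_suc, num_suc, hk, step k hk]
    exact M.ext _ _ fun k => step k (key k)

end sum

theorem injects_cantor (h : Injects (M := M) IsUnit RealEq) : Injects (M := M) IsCantor Eq := by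
  obtain ⟨F, hF⟩ := exists_sum M
  exact injects_cantor_of_sum hF h

end Model

/-- Completeness for `ACA₀^ω`. -/
theorem ACA0_proves {φ : Fml} (h : ∀ (M : Model) [M.IsACA] (e : M.Env), φ.eval e) : ACA0 ⊩ φ :=
  proves_of_valid (Set.subset_insert _ _) (fun _ hφ s => ACA0.subst hφ s) fun M hM e =>
    have : M.IsACA := ⟨hM⟩
    h M e

end HORM

theorem mainTheorem5 :
    HORM.Proves HORM.ACA0 (HORM.Fml.iff HORM.NIN HORM.NINCantor) ∧
    HORM.Proves HORM.ACA0 (HORM.Fml.iff HORM.NINCantor HORM.NINBaire) ∧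
    HORM.Proves HORM.ACA0 (HORM.Fml.iff HORM.NINBaire HORM.NINReal) := by
  open HORM Model in
  refine ⟨ACA0_proves fun M _ e => ?_, ACA0_proves fun M _ e => ?_, ACA0_proves fun M _ e => ?_⟩
  · rw [Fml.eval_iff, eval_NIN, eval_NINCantor, not_iff_not]
    exact ⟨injects_cantor, fun h => injects_unit (injects_real (injects_baire h))⟩
  · rw [Fml.eval_iff, eval_NINCantor, eval_NINBaire, not_iff_not]
    exact ⟨injects_baire, fun h => injects_cantor (injects_unit (injects_real h))⟩
  · rw [Fml.eval_iff, eval_NINBaire, eval_NINReal, not_iff_not]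
    exact ⟨injects_real, fun h => injects_baire (injects_cantor (injects_unit h))⟩
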